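/- Corollary 5.7 (cor:GMM=EVI, Existence of Minimizing Movements). Let $(X,d)$ be a metric space and let $\phi:X\to(-\infty,+\infty]$ be proper, i.e. $\mathrm{Dom}\,\phi:=\{\phi<+\infty\}\neq\emptyset$. *Definitions.* 1. $\phi$ has *complete sublevels* if $\{x\in X:\phi(x)\le c\}$ is complete for every $c\in\mathbb R$ (in particular $\phi$ is then lower semicontinuous). 2. $D\subset X$ is an *approximate length subset* if for all $x_0,x_1\in D$ and $\varepsilon\in(0,1)$ there is $x\in D$ with $d^2(x_0,x)+d^2(x,x_1)\le\frac12 d^2(x_0,x_1)\,(1+\varepsilon^2/4)$. 3. For $\lambda\in\mathbb R$ and $D\subset\overline{\mathrm{Dom}\,\phi}$, an *$\mathrm{EVI}_\lambda$-gradient flow* of $\phi$ in $D$ is a family of continuous maps $\mathsf S_t:D\to D$, $t\ge0$, such that for every $u_0\in D$: $\mathsf S_{t+h}(u_0)=\mathsf S_h(\mathsf S_t(u_0))$ for all $t,h\ge0$; $\lim_{t\downarrow0}\mathsf S_t(u_0)=\mathsf S_0(u_0)=u_0$; and the curve $u_t:=\mathsf S_t(u_0)$ is continuous on $(0,+\infty)$,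 satisfies $u_t\in\mathrm{Dom}\,\phi$ for every $t>0$, and $$\limsup_{h\downarrow0}\frac{d^2(u_{t+h},v)-d^2(u_t,v)}{2h}+\frac\lambda2 d^2(u_t,v)\le\phi(v)-\phi(u_t)\qquad\text{for every }t>0,\ v\in\mathrm{Dom}\,\phi .$$ 4. The *metric slope* is $|\partial\phi|(x):=\limsup_{y\to x}\frac{(\phi(x)-\phi(y))^+}{d(x,y)}$ if $x\in\mathrm{Dom}\,\phi$ (taken to be $0$ if $x$ is isolated), and $|\partial\phi|(x):=+\infty$ if $x\notin\mathrm{Dom}\,\phi$. 5. For $\tau>0$ and $\eta\ge0$, a *$(\tau,\eta)$-discrete Minimizing Movement* starting from $u_0$ is a sequence $(U^n)_{n\ge0}$ in $\mathrm{Dom}\,\phi$ with $U^0=u_0$ such that for every $n\ge1$ $$\frac1{2\tau}d^2(U^n,U^{n-1})+\phi(U^n)\le\frac1{2\tau}d^2(V,U^{n-1})+\phi(V)+\frac\eta2\,d(U^n,U^{n-1})\,d(V,U^n)\qquad\text{for every }V\in\mathrm{Dom}\,\phi,$$ $$\frac1{2\tau}d^2(U^n,U^{n-1})+\phi(U^n)\le\phi(U^{n-1}).$$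 Its interpolant $\overline U:[0,+\infty)\to X$ is given by $\overline U(0):=U^0$ and $\overline U(t):=U^n$ for $t\in((n-1)\tau,n\tau]$, $n\ge1$. 6. A curve $u:[0,+\infty)\to X$ with $u(0)=u_0$ is a *Minimizing Movement*, $u\in\mathrm{MM}(X,d,\phi;u_0)$, if there exist $\eta\ge0$ and, for all sufficiently small $\tau>0$, a $(\tau,\eta)$-discrete Minimizing Movement starting from $u_0$ with interpolant $\overline U_\tau$ such that $\lim_{\tau\downarrow0}\overline U_\tau(t)=u(t)$ for every $t\ge0$. It is a *Generalized Minimizing Movement*, $u\in\mathrm{GMM}(X,d,\phi;u_0)$, if there exist $\eta\ge0$, a sequence $\tau(k)>0$ with $\tau(k)\to0$ and, for every $k$, a $(\tau(k),\eta)$-discrete Minimizing Movement starting from $u_0$ with interpolant $\overline U_k$ such that $\lim_{k\to\infty}\overline U_k(t)=u(t)$ for every $t\ge0$. *Statement.* Suppose that $\phi$ has complete sublevels, that $\mathrm{Dom}\,\phi$ is an approximate length subset of $X$, and that, for some $\lambda\le0$, an $\mathrm{EVI}_\lambda$-gradient flow $(\mathsf S_t)_{t\ge0}$ of $\phi$ exists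 in $\overline{\mathrm{Dom}\,\phi}$. Then for every $u_0\in X$ with $|\partial\phi|(u_0)<+\infty$ the sets $\mathrm{GMM}(X,d,\phi;u_0)$ and $\mathrm{MM}(X,d,\phi;u_0)$ coincide, and their unique element is the curve $t\mapsto\mathsf S_t(u_0)$, $t\ge0$: $$\mathrm{GMM}(X,d,\phi;u_0)=\mathrm{MM}(X,d,\phi;u_0)=\{(\mathsf S_t(u_0))_{t\ge0}\}.$$ -/

import Mathlib

open Filter Topology Set
open scoped NNReal ENNReal

noncomputable section

namespace EVIFlow

variable {X : Type*}

/-- The domain `{φ < +∞}` of an extended-real functional. -/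
def Dom (φ : X → EReal) : Set X := {x | φ x < ⊤}

/-- `φ` takes values in `(-∞, +∞]` and is not identically `+∞`. -/
def IsProper (φ : X → EReal) : Prop := (∀ x, φ x ≠ ⊥) ∧ (Dom φ).Nonempty

variable [MetricSpace X]

/-- All sublevels `{φ ≤ c}`, `c ∈ ℝ`, are complete subsets of `X`. For a functional that never takes
the value `-∞` this includes lower semicontinuity, since complete subsets are closed. -/
def HasCompleteSublevels (φ : X → EReal) : Prop :=
  ∀ c : ℝ, IsComplete {x | φ x ≤ (c : EReal)}

/-- `x` is a `(θ, ε)`-intermediate point between `x₀` and `x₁`. -/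
def IsIntermediatePoint (θ ε : ℝ) (x₀ x₁ x : X) : Prop :=
  dist x₀ x ^ 2 / θ + dist x x₁ ^ 2 / (1 - θ) ≤ dist x₀ x₁ ^ 2 * (1 + ε ^ 2 * θ * (1 - θ))

/-- `D` is an approximate length subset: any two of its points have `ε`-midpoints in `D`, for every
`ε ∈ (0, 1)`. -/
def IsApproxLengthSubset (D : Set X) : Prop :=
  ∀ x₀ ∈ D, ∀ x₁ ∈ D, ∀ ε ∈ Ioo (0 : ℝ) 1, ∃ x ∈ D, IsIntermediatePoint (1 / 2) ε x₀ x₁ x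

open Classical in
/-- The metric slope `|∂φ|(x) = limsup_{y → x, y ≠ x} (φ x - φ y)⁺ / d(x, y)` for `x ∈ Dom φ`, and
`+∞` outside the domain. (`EReal.toENNReal` is the positive part. At an isolated point the punctured
neighbourhood filter is trivial and the `limsup` in `[0, +∞]` is `0`, as it should be.) -/
def metricSlope (φ : X → EReal) (x : X) : ℝ≥0∞ :=
  if x ∈ Dom φ then limsup (fun y => (φ x - φ y).toENNReal / edist x y) (𝓝[≠] x) else ⊤

/-- The upper right Dini derivative `limsup_{h ↓ 0} (f (t + h) - f t) / h`, in `[-∞, +∞]`. -/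
def upperRightDeriv (f : ℝ → ℝ) (t : ℝ) : EReal :=
  limsup (fun h : ℝ => (((f (t + h) - f t) / h : ℝ) : EReal)) (𝓝[>] 0)

/-- `u`, restricted to `(0, +∞)`, is a solution of the Evolution Variational Inequality `EVI_lam`.
Since `v` and `u t` lie in the domain, the right-hand side is a difference of real numbers. -/
structure IsEVISolution (φ : X → EReal) (lam : ℝ) (u : ℝ → X) : Prop where
  continuousOn : ContinuousOn u (Ioi 0)
  mem_dom : ∀ t, 0 < t → u t ∈ Dom φ
  evi : ∀ t, 0 < t → ∀ v ∈ Dom φ,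
    upperRightDeriv (fun s => (1 / 2) * dist (u s) v ^ 2) t
      + ((lam / 2 * dist (u t) v ^ 2 : ℝ) : EReal) ≤ φ v - φ (u t)

/-- `(S t)_{t ≥ 0}` is an `EVI_lam`-gradient flow of `φ` in `D ⊆ closure (Dom φ)`. Only the values
`S t x` with `0 ≤ t` and `x ∈ D` matter. -/
structure IsEVIGradientFlow (φ : X → EReal) (lam : ℝ) (D : Set X) (S : ℝ → X → X) : Prop where
  subset_closure : D ⊆ closure (Dom φ)
  mapsTo : ∀ t, 0 ≤ t → MapsTo (S t) D D
  continuousOn : ∀ t, 0 ≤ t → ContinuousOn (S t) D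
  semigroup : ∀ x ∈ D, ∀ t h, 0 ≤ t → 0 ≤ h → S (t + h) x = S h (S t x)
  zero : ∀ x ∈ D, S 0 x = x
  tendsto_zero : ∀ x ∈ D, Tendsto (fun t => S t x) (𝓝[>] 0) (𝓝 x)
  isSolution : ∀ x ∈ D, IsEVISolution φ lam (fun t => S t x)

/-- The Moreau-Yosida-Ekeland resolvent of `x` with step `τ` and relaxation parameter `η`. -/
def ekelandResolvent (φ : X → EReal) (τ η : ℝ) (x : X) : Set X :=
  {z | z ∈ Dom φ ∧
    (∀ y : X, ((dist x z ^ 2 / (2 * τ) : ℝ) : EReal) + φ z ≤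
      ((dist x y ^ 2 / (2 * τ) : ℝ) : EReal) + φ y
        + ((η / 2 * dist x z * dist y z : ℝ) : EReal)) ∧
    ((dist x z ^ 2 / (2 * τ) : ℝ) : EReal) + φ z ≤ φ x}

/-- The `(τ, η)`-discrete Minimizing Movements starting from `x`. -/
def discreteMM (φ : X → EReal) (τ η : ℝ) (x : X) : Set (ℕ → X) :=
  {U | U 0 = x ∧ (∀ n, U n ∈ Dom φ) ∧ ∀ n, U (n + 1) ∈ ekelandResolvent φ τ η (U n)}

/-- The piecewise constant interpolant with step `τ > 0`: it equals `U 0` at `t = 0` and `U n` for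
`t ∈ ((n - 1) τ, n τ]`, `n ≥ 1`, that is for `⌈t / τ⌉ = n`. -/
def interpolant (τ : ℝ) (U : ℕ → X) (t : ℝ≥0) : X := U ⌈(t : ℝ) / τ⌉₊

/-- The set `MM(X, d, φ; u₀)` of Minimizing Movements starting from `u₀`. -/
def minimizingMovements (φ : X → EReal) (u₀ : X) : Set (ℝ≥0 → X) :=
  {u | u 0 = u₀ ∧ ∃ η : ℝ, 0 ≤ η ∧ ∃ τ₀ : ℝ, 0 < τ₀ ∧ ∃ U : ℝ → ℕ → X,
    (∀ τ ∈ Ioo 0 τ₀, U τ ∈ discreteMM φ τ η u₀) ∧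
    ∀ t : ℝ≥0, Tendsto (fun τ => interpolant τ (U τ) t) (𝓝[>] 0) (𝓝 (u t))}

/-- The set `GMM(X, d, φ; u₀)` of Generalized Minimizing Movements starting from `u₀`. -/
def generalizedMinimizingMovements (φ : X → EReal) (u₀ : X) : Set (ℝ≥0 → X) :=
  {u | u 0 = u₀ ∧ ∃ η : ℝ, 0 ≤ η ∧ ∃ τ : ℕ → ℝ, (∀ k, 0 < τ k) ∧ Tendsto τ atTop (𝓝 0) ∧
    ∃ U : ℕ → ℕ → X, (∀ k, U k ∈ discreteMM φ (τ k) η u₀) ∧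
    ∀ t : ℝ≥0, Tendsto (fun k => interpolant (τ k) (U k) t) atTop (𝓝 (u t))}

end EVIFlow

end

/-! The flow itself supplies the convexity that makes the scheme converge. Running the EVI for a
short time from an approximate midpoint produces a point satisfying the midpoint inequality of
`-ℓ`-convexity up to a small error (`exists_midpoint`); bisection extends this to parameters 2^-k
(`exists_interpolant`). Hence a finite slope at u₀ becomes the global bound `HasSlopeBound`, and a
relaxed resolvent z of x with step τ, at distance d from x, satisfies (1/τ - O(1)) d² ≤ f x - f z
and has slope at most d (1/τ + O(1)).

The core is `resolvent_step`. If x has slope bound G, the EVI tested at z gives d²(S_τ x, z) ≤ G²τ²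
- d² up to factors 1 + O(τ), so (slope at z)² + (local error / τ)² ≤ (1 + O(τ)) G². Iterating, the
squared local errors sum to O(τ²G²); Cauchy-Schwarz bounds the sum of n local errors by O(G √(nτ ·
τ)), and `contraction` turns this into a global error O(√τ) (`discrete_error`).

Thus discrete movements converge to the flow for every η ≥ 0. They exist for η = 1 and small τ by
Ekeland's principle (`exists_resolvent`), so neither set is empty. -/

namespace EVIFlow

/-! ### Consequences of the EVI: energy decay, integrated form, contraction. -/

/-- Real-valued form of an `EVI` flow with constant `-ℓ < 0` of the functional `f` on its domain
`D`, with closed sublevels. -/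
structure RealFlow {X : Type*} [MetricSpace X] (D : Set X) (f : X → ℝ) (ℓ : ℝ)
    (S : ℝ → X → X) : Prop where
  pos : 0 < ℓ
  mem : ∀ x ∈ D, ∀ t, 0 ≤ t → S t x ∈ D
  zero : ∀ x ∈ D, S 0 x = x
  semigroup : ∀ x ∈ D, ∀ t h, 0 ≤ t → 0 ≤ h → S (t + h) x = S h (S t x)
  cont : ∀ x ∈ D, ContinuousOn (fun t => S t x) (Ici 0)
  closed : ∀ c : ℝ, IsClosed {x | x ∈ D ∧ f x ≤ c}
  evi : ∀ x ∈ D, ∀ t, 0 < t → ∀ v ∈ D, ∀ c : ℝ,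
    f v - f (S t x) + ℓ / 2 * dist (S t x) v ^ 2 < c →
    ∀ᶠ h in 𝓝[>] (0 : ℝ),
      ((1 / 2) * dist (S (t + h) x) v ^ 2 - (1 / 2) * dist (S t x) v ^ 2) / h < c

theorem le_of_forall_pos_of_continuousAt {a : ℝ} {F : ℝ → ℝ} (hF : ContinuousAt F 0)
    (h : ∀ ε, 0 < ε → a ≤ F ε) : a ≤ F 0 := by
  have h1 : Tendsto F (𝓝[>] 0) (𝓝 (F 0)) := hF.tendsto.mono_left nhdsWithin_le_nhds
  refine ge_of_tendsto h1 ?_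
  filter_upwards [self_mem_nhdsWithin] with ε hε using h ε hε

/-- The solution at time `t` of `k' = ℓ k + 1`, `k 0 = 0`. -/
noncomputable def expKernel (ℓ t : ℝ) : ℝ := (Real.exp (ℓ * t) - 1) / ℓ

theorem expKernel_hasDerivAt {ℓ : ℝ} (hℓ : 0 < ℓ) (t : ℝ) :
    HasDerivAt (expKernel ℓ) (Real.exp (ℓ * t)) t := by
  have h1 : HasDerivAt (fun t => Real.exp (ℓ * t)) (Real.exp (ℓ * t) * (ℓ * 1)) t :=
    ((hasDerivAt_id t).const_mul ℓ).exp
  have h2 := (h1.sub_const 1).div_const ℓ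
  rwa [show Real.exp (ℓ * t) * (ℓ * 1) / ℓ = Real.exp (ℓ * t) by field_simp] at h2

theorem mul_expKernel {ℓ : ℝ} (hℓ : 0 < ℓ) (t : ℝ) :
    ℓ * expKernel ℓ t = Real.exp (ℓ * t) - 1 := by
  unfold expKernel
  field_simp

theorem le_expKernel {ℓ : ℝ} (hℓ : 0 < ℓ) (t : ℝ) : t ≤ expKernel ℓ t := by
  unfold expKernel
  rw [le_div_iff₀ hℓ]
  linarith [Real.add_one_le_exp (ℓ * t)]

theorem expKernel_le {ℓ : ℝ} (hℓ : 0 < ℓ) (t : ℝ) :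
    expKernel ℓ t ≤ t * Real.exp (ℓ * t) := by
  unfold expKernel
  rw [div_le_iff₀ hℓ]
  have h1 := Real.add_one_le_exp (-(ℓ * t))
  have h2 : Real.exp (-(ℓ * t)) * Real.exp (ℓ * t) = 1 := by
    rw [← Real.exp_add]; simp
  nlinarith [Real.exp_pos (ℓ * t)]

theorem one_le_exp_mul {ℓ t : ℝ} (hℓ : 0 < ℓ) (ht : 0 ≤ t) : 1 ≤ Real.exp (ℓ * t) :=
  Real.one_le_exp (by positivity)

namespace RealFlow

variable {X : Type*} [MetricSpace X] {D : Set X} {f : X → ℝ} {ℓ : ℝ} {S : ℝ → X → X}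

/-- Comparison principle: the squared distance from a fixed point stays below strict
supersolutions of the evolution variational inequality. -/
theorem compare (H : RealFlow D f ℓ S) {x v : X} (hx : x ∈ D) (hv : v ∈ D) {t : ℝ} (ht : 0 ≤ t)
    {B B' : ℝ → ℝ} (hB : ∀ r, HasDerivAt B (B' r) r) (h0 : 1 / 2 * dist x v ^ 2 < B 0)
    (hb : ∀ r ∈ Ioo 0 t, 1 / 2 * dist (S r x) v ^ 2 = B r →
      ℓ * B r + f v - f (S r x) < B' r) :
    1 / 2 * dist (S t x) v ^ 2 ≤ B t := by
  rcases ht.eq_or_lt with rfl | ht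
  · rw [H.zero x hx]; exact h0.le
  have hBc : Continuous B := continuous_iff_continuousAt.2 fun r => (hB r).continuousAt
  have hgc : ContinuousOn (fun r => 1 / 2 * dist (S r x) v ^ 2) (Ici 0) := by
    have := H.cont x hx
    fun_prop
  have hev : ∀ᶠ r in 𝓝[≥] (0 : ℝ), 1 / 2 * dist (S r x) v ^ 2 < B r := by
    have h1 := hgc 0 self_mem_Ici
    refine h1.eventually_lt hBc.continuousWithinAt ?_
    simpa [H.zero x hx] using h0
  have hev2 : ∀ᶠ r in 𝓝[>] (0 : ℝ), 1 / 2 * dist (S r x) v ^ 2 < B r ∧ r ∈ Ioo 0 t :=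
    (hev.filter_mono (nhdsWithin_mono _ Ioi_subset_Ici_self)).and (Ioo_mem_nhdsGT ht)
  obtain ⟨a, ha, ha0, hat⟩ := hev2.exists
  -- The EVI holds only at positive times, so the comparison starts at some `a > 0` where the strict
  -- initial inequality persists.
  refine image_le_of_liminf_slope_right_lt_deriv_boundary'
    (f := fun r => 1 / 2 * dist (S r x) v ^ 2)
    (f' := fun r => ℓ * (1 / 2 * dist (S r x) v ^ 2) + f v - f (S r x)) (a := a) (b := t)
    (hgc.mono fun r hr => ha0.le.trans hr.1) ?_ ha.le hBc.continuousOn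
    (fun r _ => (hB r).hasDerivWithinAt) ?_ ⟨hat.le, le_rfl⟩
  · intro r hr c hc
    refine Eventually.frequently ?_
    have h1 := H.evi x hx r (ha0.trans_le hr.1) v hv c (by linarith)
    have h2 : Tendsto (fun z => z - r) (𝓝[>] r) (𝓝[>] 0) := by
      refine tendsto_nhdsWithin_iff.2 ⟨?_, ?_⟩
      · refine Tendsto.mono_left ?_ nhdsWithin_le_nhds
        simpa using (tendsto_id (x := 𝓝 r)).sub_const r
      · filter_upwards [self_mem_nhdsWithin] with z hz using mem_Ioi.2 (sub_pos.2 (mem_Ioi.1 hz))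
    filter_upwards [h2.eventually h1] with z hz
    simpa [slope_def_field] using hz
  · intro r hr heq
    have := hb r ⟨ha0.trans_le hr.1, hr.2⟩ heq
    rwa [heq]

/-- If the energy exceeded `f x` at time `t`, let `a` be the last time at which it is at most `f x`.
After `a` the energy stays above that of `S a x`, so the EVI tested at `S a x` and Gronwall keep the
curve at `S a x`, a contradiction. -/
theorem apply_flow_le (H : RealFlow D f ℓ S) {x : X} (hx : x ∈ D) {t : ℝ} (ht : 0 ≤ t) :
    f (S t x) ≤ f x := by
  by_contra! hlt
  have hK : IsCompact {r ∈ Icc 0 t | S r x ∈ {y | y ∈ D ∧ f y ≤ f x}} := by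
    refine isCompact_Icc.of_isClosed_subset ?_ (sep_subset _ _)
    exact ((H.cont x hx).mono Icc_subset_Ici_self).preimage_isClosed_of_isClosed isClosed_Icc
      (H.closed (f x))
  obtain ⟨a, ⟨ha, haD, hafx⟩, hmax⟩ :=
    hK.exists_isGreatest ⟨0, ⟨le_rfl, ht⟩, by simp [H.zero x hx, hx]⟩
  have hat : a < t := by
    rcases ha.2.eq_or_lt with rfl | h
    · exact absurd hafx (not_le.2 hlt)
    · exact h
  have hstep : ∀ r, 0 ≤ r → S (a + r) x = S r (S a x) := fun r hr =>
    H.semigroup x hx a r ha.1 hr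
  have hhigh : ∀ r, 0 < r → r ≤ t - a → f x < f (S r (S a x)) := by
    intro r hr hrt
    by_contra! hle
    have : a + r ≤ a := hmax ⟨⟨by linarith [ha.1], by linarith⟩, by
      rw [hstep r hr.le]; exact ⟨H.mem _ haD r hr.le, hle⟩⟩
    linarith
  have key : ∀ ε, 0 < ε → 1 / 2 * dist (S (t - a) (S a x)) (S a x) ^ 2
      ≤ ε * Real.exp (2 * ℓ * (t - a)) := by
    intro ε hε
    refine H.compare haD haD (by linarith) (B := fun r => ε * Real.exp (2 * ℓ * r))
      (B' := fun r => ε * (Real.exp (2 * ℓ * r) * (2 * ℓ * 1)))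
      (fun r => (((hasDerivAt_id r).const_mul (2 * ℓ)).exp).const_mul ε) (by simpa using hε) ?_
    intro r hr _
    have h1 := hhigh r hr.1 hr.2.le
    have h2 : 0 < ε * Real.exp (2 * ℓ * r) * ℓ := by have := H.pos; positivity
    nlinarith
  have h0 := le_of_forall_pos_of_continuousAt
    (F := fun ε => ε * Real.exp (2 * ℓ * (t - a))) (by fun_prop) key
  have h1 : dist (S (t - a) (S a x)) (S a x) = 0 := by
    have : dist (S (t - a) (S a x)) (S a x) ^ 2 ≤ 0 := by
      rw [zero_mul] at h0; linarith
    exact pow_eq_zero_iff two_ne_zero |>.1 (le_antisymm this (sq_nonneg _))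
  have h2 := hhigh (t - a) (by linarith) le_rfl
  rw [dist_eq_zero.1 h1] at h2
  linarith

theorem antitone_apply (H : RealFlow D f ℓ S) {x : X} (hx : x ∈ D) {s t : ℝ} (hs : 0 ≤ s)
    (hst : s ≤ t) : f (S t x) ≤ f (S s x) := by
  have h := H.semigroup x hx s (t - s) hs (by linarith)
  rw [add_sub_cancel] at h
  rw [h]
  exact H.apply_flow_le (H.mem x hx s hs) (by linarith)

/-- Integrated form of the evolution variational inequality. -/
theorem integrated (H : RealFlow D f ℓ S) {x v : X} (hx : x ∈ D) (hv : v ∈ D) {t : ℝ}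
    (ht : 0 ≤ t) :
    1 / 2 * dist (S t x) v ^ 2 ≤
      Real.exp (ℓ * t) * (1 / 2 * dist x v ^ 2) + expKernel ℓ t * (f v - f (S t x)) := by
  have key : ∀ ε, 0 < ε → 1 / 2 * dist (S t x) v ^ 2 ≤
      Real.exp (ℓ * t) * (1 / 2 * dist x v ^ 2 + ε)
        + expKernel ℓ t * (f v - f (S t x) + ε) := by
    intro ε hε
    refine H.compare hx hv ht
      (B := fun r => Real.exp (ℓ * r) * (1 / 2 * dist x v ^ 2 + ε)
        + expKernel ℓ r * (f v - f (S t x) + ε))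
      (B' := fun r => Real.exp (ℓ * r) * (ℓ * 1) * (1 / 2 * dist x v ^ 2 + ε)
        + Real.exp (ℓ * r) * (f v - f (S t x) + ε))
      (fun r => ((((hasDerivAt_id r).const_mul ℓ).exp).mul_const _).add
        ((expKernel_hasDerivAt H.pos r).mul_const _)) ?_ ?_
    · simp [expKernel]; exact hε
    · intro r hr _
      -- Replacing `f (S r x)` by the smaller `f (S t x)` leaves a linear equation with constant
      -- source, solved exactly by the barrier.
      have h1 := H.antitone_apply hx hr.1.le hr.2.le
      have h2 := mul_expKernel H.pos r
      have h3 : ℓ * (Real.exp (ℓ * r) * (1 / 2 * dist x v ^ 2 + ε)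
          + expKernel ℓ r * (f v - f (S t x) + ε))
          = Real.exp (ℓ * r) * (ℓ * 1) * (1 / 2 * dist x v ^ 2 + ε)
          + (ℓ * expKernel ℓ r) * (f v - f (S t x) + ε) := by ring
      simp only [h3, h2]
      linarith
  have h0 := le_of_forall_pos_of_continuousAt
    (F := fun ε => Real.exp (ℓ * t) * (1 / 2 * dist x v ^ 2 + ε)
      + expKernel ℓ t * (f v - f (S t x) + ε)) (by fun_prop) key
  simpa using h0

/-- Discard the left-hand side of the integrated EVI at time 1; there `expKernel ℓ 1 ≥ 1`. -/
theorem exists_quadratic_lower_bound (H : RealFlow D f ℓ S) {w : X} (hw : w ∈ D) :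
    ∃ a b : ℝ, 0 ≤ a ∧ 0 ≤ b ∧ ∀ v ∈ D, -a - b * dist w v ^ 2 ≤ f v := by
  refine ⟨|f (S 1 w)|, Real.exp ℓ / 2, abs_nonneg _, by positivity, fun v hv => ?_⟩
  have h1 := H.integrated hw hv zero_le_one
  rw [mul_one] at h1
  have h2 := le_expKernel H.pos 1
  have h3 := neg_abs_le (f (S 1 w))
  have h4 : 0 ≤ Real.exp ℓ / 2 * dist w v ^ 2 := by positivity
  have h5 : 0 ≤ dist (S 1 w) v ^ 2 := by positivity
  by_contra! hlt
  nlinarith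

/-- Split `[0, T]` into steps of length `h`. On each, test the integrated EVI for x at the new
position of y, and the one for y at the old position of x. The energies of y cancel to leading order
and those of x telescope, so the total error is O(h). -/
theorem contraction (H : RealFlow D f ℓ S) {x y : X} (hx : x ∈ D) (hy : y ∈ D) {T : ℝ}
    (hT : 0 ≤ T) : dist (S T x) (S T y) ≤ Real.exp (ℓ * T) * dist x y := by
  set K := |f x - f (S T y)| with hK
  have step : ∀ h, 0 ≤ h → ∀ n : ℕ, n * h ≤ T →
      1 / 2 * dist (S (n * h) x) (S (n * h) y) ^ 2 ≤ Real.exp (2 * (ℓ * h)) ^ n *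
        (1 / 2 * dist x y ^ 2 + expKernel ℓ h *
          (f x - f (S (n * h) x) + n * ((Real.exp (ℓ * h) - 1) * K))) := by
    intro h hh n
    induction n with
    | zero => intro _; simp [H.zero x hx, H.zero y hy]
    | succ n ih =>
      intro hn
      push_cast at hn ⊢
      have hnh : 0 ≤ (n : ℝ) * h := by positivity
      have ih' := ih (by linarith)
      have hq : 1 ≤ Real.exp (2 * (ℓ * h)) := Real.one_le_exp (by have := H.pos; positivity)
      have he := one_le_exp_mul H.pos hh
      have hk : 0 ≤ expKernel ℓ h := hh.trans (le_expKernel H.pos h)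
      have hsx := H.semigroup x hx (n * h) h hnh hh
      have hsy := H.semigroup y hy (n * h) h hnh hh
      rw [show ((n : ℝ) + 1) * h = n * h + h by ring] at hn ⊢
      have hxD := H.mem x hx _ hnh
      have hyD := H.mem y hy _ hnh
      have hyD' := H.mem y hy (n * h + h) (by linarith)
      have m1 := H.antitone_apply hx hnh (show (n : ℝ) * h ≤ n * h + h by linarith)
      have m2 := H.antitone_apply hy (by linarith) hn
      have m3 := H.antitone_apply hx le_rfl hnh
      rw [H.zero x hx] at m3
      have i1 := H.integrated hxD hyD' hh
      have i2 := H.integrated hyD hxD hh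
      rw [← hsx] at i1
      rw [← hsy, dist_comm] at i2
      rw [dist_comm (S (n * h) y)] at i2
      generalize S (n * h) x = x1 at *
      generalize S (n * h) y = y1 at *
      generalize S (n * h + h) x = x2 at *
      generalize S (n * h + h) y = y2 at *
      have hKle : f x1 - f y2 ≤ K := by
        rw [hK]; linarith [le_abs_self (f x - f (S T y))]
      have hexp : Real.exp (2 * (ℓ * h)) = Real.exp (ℓ * h) * Real.exp (ℓ * h) := by
        rw [← Real.exp_add]; ring_nf
      have c1 : 1 / 2 * dist x2 y2 ^ 2 ≤ Real.exp (2 * (ℓ * h)) * (1 / 2 * dist x1 y1 ^ 2)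
          + expKernel ℓ h * ((f x1 - f x2) + (Real.exp (ℓ * h) - 1) * (f x1 - f y2)) := by
        rw [hexp]
        nlinarith [mul_le_mul_of_nonneg_left i2 (Real.exp_pos (ℓ * h)).le]
      have hK0 : 0 ≤ K := abs_nonneg _
      set e := Real.exp (ℓ * h) - 1
      have he0 : 0 ≤ e := by simp only [e]; linarith
      set q := Real.exp (2 * (ℓ * h))
      have hqn : 1 ≤ q ^ (n + 1) := one_le_pow₀ hq
      have c2 : expKernel ℓ h * ((f x1 - f x2) + e * (f x1 - f y2)) ≤
          q ^ (n + 1) * (expKernel ℓ h * ((f x1 - f x2) + e * K)) := by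
        have d1 : expKernel ℓ h * ((f x1 - f x2) + e * (f x1 - f y2)) ≤
          expKernel ℓ h * ((f x1 - f x2) + e * K) := by gcongr
        have d2 : 0 ≤ expKernel ℓ h * ((f x1 - f x2) + e * K) :=
          mul_nonneg hk (add_nonneg (by linarith) (by positivity))
        nlinarith
      calc _ ≤ _ := c1
        _ ≤ q * (q ^ n * (1 / 2 * dist x y ^ 2 + expKernel ℓ h * (f x - f x1 + n * (e * K))))
            + q ^ (n + 1) * (expKernel ℓ h * ((f x1 - f x2) + e * K)) := by gcongr
        _ = _ := by ring
  have main : ∀ N : ℕ, 1 / 2 * dist (S T x) (S T y) ^ 2 ≤ Real.exp (2 * (ℓ * T)) *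
      (1 / 2 * dist x y ^ 2 + T * Real.exp (ℓ * T) *
        (f x - f (S T x) + ℓ * T * Real.exp (ℓ * T) * K) * (1 / ((N : ℝ) + 1))) := by
    intro N
    have hN : (0 : ℝ) < (N : ℝ) + 1 := by positivity
    have hh : 0 ≤ T / ((N : ℝ) + 1) := by positivity
    have hNh : ((N + 1 : ℕ) : ℝ) * (T / ((N : ℝ) + 1)) = T := by push_cast; field_simp
    have h1 := step _ hh (N + 1) hNh.le
    rw [hNh, ← Real.exp_nat_mul, show ((N + 1 : ℕ) : ℝ) * (2 * (ℓ * (T / ((N : ℝ) + 1))))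
      = 2 * (ℓ * T) by rw [← hNh]; push_cast; field_simp] at h1
    refine h1.trans ?_
    have hK0 : 0 ≤ K := abs_nonneg _
    have m := H.apply_flow_le hx hT
    have hℓ := H.pos
    have k1 : expKernel ℓ (T / ((N : ℝ) + 1)) ≤ T / ((N : ℝ) + 1) * Real.exp (ℓ * T) := by
      refine (expKernel_le H.pos _).trans ?_
      gcongr
      exact div_le_self hT (by linarith [(Nat.cast_nonneg N : (0 : ℝ) ≤ N)])
    have k0 : 0 ≤ expKernel ℓ (T / ((N : ℝ) + 1)) := hh.trans (le_expKernel H.pos _)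
    have k2 : ((N + 1 : ℕ) : ℝ) * ((Real.exp (ℓ * (T / ((N : ℝ) + 1))) - 1) * K)
        ≤ ℓ * T * Real.exp (ℓ * T) * K := by
      rw [← mul_expKernel H.pos]
      calc _ ≤ ((N + 1 : ℕ) : ℝ) * ((ℓ * (T / ((N : ℝ) + 1) * Real.exp (ℓ * T))) * K) := by
            gcongr
        _ = _ := by push_cast; field_simp
    have k3 : 0 ≤ f x - f (S T x) + ℓ * T * Real.exp (ℓ * T) * K :=
      add_nonneg (by linarith) (by positivity)
    calc _ ≤ Real.exp (2 * (ℓ * T)) * (1 / 2 * dist x y ^ 2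
          + (T / ((N : ℝ) + 1) * Real.exp (ℓ * T)) *
            (f x - f (S T x) + ℓ * T * Real.exp (ℓ * T) * K)) := by
          have k4 := (mul_le_mul_of_nonneg_left (add_le_add_right k2 (f x - f (S T x))) k0).trans
            (mul_le_mul_of_nonneg_right k1 k3)
          gcongr
      _ = _ := by ring
  have lim := ge_of_tendsto' ((tendsto_one_div_add_atTop_nhds_zero_nat (𝕜 := ℝ)).const_mul
    (T * Real.exp (ℓ * T) * (f x - f (S T x) + ℓ * T * Real.exp (ℓ * T) * K))
    |>.const_add (1 / 2 * dist x y ^ 2) |>.const_mul (Real.exp (2 * (ℓ * T)))) main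
  have hexp : Real.exp (2 * (ℓ * T)) = Real.exp (ℓ * T) * Real.exp (ℓ * T) := by
    rw [← Real.exp_add]; ring_nf
  rw [hexp] at lim
  refine abs_le_of_sq_le_sq' ?_ (by positivity) |>.2
  nlinarith

end RealFlow

end EVIFlow

/-! ### Approximate convexity of the energy. -/

namespace EVIFlow

theorem le_of_eventually_of_continuousAt {a : ℝ} {F : ℝ → ℝ} (hF : ContinuousAt F 0)
    (h : ∀ᶠ ε in 𝓝[>] (0 : ℝ), a ≤ F ε) : a ≤ F 0 :=
  ge_of_tendsto (hF.tendsto.mono_left nhdsWithin_le_nhds) h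

theorem eventually_nhdsGT_lt {c : ℝ} {F : ℝ → ℝ} (hF : ContinuousAt F 0) (h : F 0 < c) :
    ∀ᶠ t in 𝓝[>] (0 : ℝ), F t < c :=
  (hF.tendsto.mono_left nhdsWithin_le_nhds).eventually_lt_const h

theorem le_of_forall_half_pow {a : ℝ} {F : ℝ → ℝ} (hF : ContinuousAt F 0)
    (h : ∀ k : ℕ, a ≤ F ((1 / 2) ^ k)) : a ≤ F 0 :=
  ge_of_tendsto' (hF.tendsto.comp
    (tendsto_pow_atTop_nhds_zero_of_lt_one (by norm_num) (by norm_num))) h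

/-- If `a² + b²` is almost `d² / 2` and `a + b ≥ d`, then `a` is almost `d / 2`. -/
theorem le_half_add_of_sq_add_sq_le {a b d ε : ℝ} (hd : 0 ≤ d) (hε : 0 ≤ ε) (hab : d ≤ a + b)
    (h : a ^ 2 + b ^ 2 ≤ 1 / 2 * d ^ 2 + ε ^ 2 / 2) : a ≤ d / 2 + ε := by
  have h1 : (a + b) ^ 2 + (a - b) ^ 2 ≤ d ^ 2 + ε ^ 2 := by nlinarith
  have h2 : a - b ≤ ε := by
    refine abs_le_of_sq_le_sq' ?_ hε |>.2
    nlinarith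
  have h3 : a + b ≤ d + ε := by
    refine abs_le_of_sq_le_sq' ?_ (by positivity) |>.2
    nlinarith [sq_nonneg (a - b), mul_nonneg hd hε]
  linarith

/-- Here p, q are the distances from the flowed midpoint to the endpoints, F its energy. Adding `i0`
and `i1` bounds p² + q² above once F is bounded below; conversely p² + q² ≥ d²/2 bounds F above
after division by k. -/
theorem midpoint_estimate {ℓ a b d k E t ε F₀ F₁ F m₀ m₁ p q : ℝ} (hk : 0 < k) (hkt : t ≤ k)
    (ht : 0 ≤ t) (hE0 : 0 < E) (hE : ℓ * k = E - 1) (hb : 0 ≤ b) (hbk : 2 * b * k < 1 / 2)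
    (hd0 : 0 ≤ d) (htri : d ≤ p + q)
    (hmid : m₀ ^ 2 + m₁ ^ 2 ≤ 1 / 2 * d ^ 2 * (1 + t ^ 2 / 4))
    (i0 : 1 / 2 * p ^ 2 ≤ E * (1 / 2 * m₀ ^ 2) + k * (F₀ - F))
    (i1 : 1 / 2 * q ^ 2 ≤ E * (1 / 2 * m₁ ^ 2) + k * (F₁ - F))
    (hl : -a - b * p ^ 2 ≤ F)
    (hsmall : E * (1 / 4 * d ^ 2 * (1 + t ^ 2 / 4)) + k * (F₀ + F₁ + 2 * a)
      - (1 / 2 - 2 * b * k) * (1 / 2 * d ^ 2 + ε ^ 2 / 2) < 0) :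
    p ^ 2 + q ^ 2 ≤ 1 / 2 * d ^ 2 + ε ^ 2 / 2 ∧
      2 * F - F₀ - F₁ ≤ 2 * (1 / 8 * d ^ 2 * (ℓ + E * t / 4)) := by
  have h1 := mul_le_mul_of_nonneg_left hmid hE0.le
  have hsum : 1 / 2 * (p ^ 2 + q ^ 2) ≤ E * (1 / 4 * d ^ 2 * (1 + t ^ 2 / 4))
      + k * (F₀ + F₁ - 2 * F) := by linarith
  constructor
  · have c0 : 0 ≤ b * q ^ 2 := by positivity
    have c1 : k * (F₀ + F₁ - 2 * F) ≤ k * (F₀ + F₁ + 2 * a + 2 * b * (p ^ 2 + q ^ 2)) :=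
      mul_le_mul_of_nonneg_left (by linarith) hk.le
    have c2 : (1 / 2 - 2 * b * k) * (p ^ 2 + q ^ 2)
      ≤ (1 / 2 - 2 * b * k) * (1 / 2 * d ^ 2 + ε ^ 2 / 2) := by linarith
    exact le_of_mul_le_mul_left c2 (by linarith)
  · have h2 : d ^ 2 ≤ (p + q) ^ 2 := by gcongr
    have hpq : 1 / 2 * d ^ 2 ≤ p ^ 2 + q ^ 2 := by linarith [sq_nonneg (p - q)]
    have e2 : E * d ^ 2 * (t * t) ≤ E * d ^ 2 * (k * t) := by gcongr
    have e3 : d ^ 2 * (ℓ * k) = d ^ 2 * (E - 1) := by rw [hE]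
    refine le_of_mul_le_mul_left ?_ hk
    linarith

/-- Global lower bound of `f` around `x` with linear coefficient `G` and quadratic
coefficient `ℓ / 2`. -/
def HasSlopeBound {X : Type*} [MetricSpace X] (D : Set X) (f : X → ℝ) (ℓ G : ℝ) (x : X) : Prop :=
  ∀ v ∈ D, f x - f v ≤ G * dist x v + ℓ / 2 * dist x v ^ 2

/-- Real-valued form of the relation `z ∈ ekelandResolvent φ τ η x`. -/
structure IsRealResolvent {X : Type*} [MetricSpace X] (D : Set X) (f : X → ℝ) (τ η : ℝ)
    (x z : X) : Prop where
  mem : z ∈ D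
  minimal : ∀ y ∈ D, dist x z ^ 2 / (2 * τ) + f z ≤
    dist x y ^ 2 / (2 * τ) + f y + η / 2 * dist x z * dist y z
  decrease : dist x z ^ 2 / (2 * τ) + f z ≤ f x

namespace RealFlow

variable {X : Type*} [MetricSpace X] {D : Set X} {f : X → ℝ} {ℓ : ℝ} {S : ℝ → X → X}

theorem exists_midpoint (H : RealFlow D f ℓ S) (hD : IsApproxLengthSubset D) {x₀ x₁ : X}
    (h₀ : x₀ ∈ D) (h₁ : x₁ ∈ D) {ε : ℝ} (hε : 0 < ε) :
    ∃ y ∈ D, dist x₀ y ≤ dist x₀ x₁ / 2 + ε ∧ dist y x₁ ≤ dist x₀ x₁ / 2 + ε ∧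
      f y ≤ 1 / 2 * f x₀ + 1 / 2 * f x₁ + ℓ / 8 * dist x₀ x₁ ^ 2 + ε := by
  obtain ⟨a, b, ha, hb, hlow⟩ := H.exists_quadratic_lower_bound h₀
  set d := dist x₀ x₁ with hd
  have hk0 : expKernel ℓ 0 = 0 := by simp [expKernel]
  have hkc : ContinuousAt (expKernel ℓ) 0 := (expKernel_hasDerivAt H.pos 0).continuousAt
  have ev1 := eventually_nhdsGT_lt (c := ℓ / 8 * d ^ 2 + ε)
    (F := fun t => 1 / 8 * d ^ 2 * (ℓ + Real.exp (ℓ * t) * t / 4)) (by fun_prop)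
    (by norm_num; linarith)
  have ev2 := eventually_nhdsGT_lt (c := 0)
    (F := fun t => Real.exp (ℓ * t) * (1 / 4 * d ^ 2 * (1 + t ^ 2 / 4))
      + expKernel ℓ t * (f x₀ + f x₁ + 2 * a)
      - (1 / 2 - 2 * b * expKernel ℓ t) * (1 / 2 * d ^ 2 + ε ^ 2 / 2)) (by fun_prop)
    (by simp only [hk0]; norm_num; nlinarith)
  have ev3 := eventually_nhdsGT_lt (c := 1 / 2) (F := fun t => 2 * b * expKernel ℓ t)
    (by fun_prop) (by simp only [hk0]; norm_num)
  obtain ⟨t, ht1, ht2, ht3, ht⟩ :=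
    (ev1.and (ev2.and (ev3.and (Ioo_mem_nhdsGT (zero_lt_one' ℝ))))).exists
  -- The midpoint tolerance equals the flow time: its defect is of order t², hence negligible after
  -- division by `expKernel ℓ t ≥ t`.
  obtain ⟨m, hm, hmid⟩ := hD x₀ h₀ x₁ h₁ t ht
  unfold IsIntermediatePoint at hmid
  have hmid' : dist m x₀ ^ 2 + dist m x₁ ^ 2 ≤ 1 / 2 * d ^ 2 * (1 + t ^ 2 / 4) := by
    rw [dist_comm m x₀]
    norm_num at hmid
    linarith
  have hy := H.mem m hm t ht.1.le
  have i0 := H.integrated hm h₀ ht.1.le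
  have i1 := H.integrated hm h₁ ht.1.le
  have hl := hlow _ hy
  have hkt := le_expKernel H.pos t
  have hE := mul_expKernel H.pos t
  have hE0 := Real.exp_pos (ℓ * t)
  have htri := dist_triangle x₀ (S t m) x₁
  rw [← hd, dist_comm x₀ (S t m)] at htri
  rw [dist_comm x₀ (S t m)] at hl
  generalize S t m = y at *
  set p := dist y x₀
  set q := dist y x₁
  set k := expKernel ℓ t
  have hk : 0 < k := ht.1.trans_le hkt
  have hp : 0 ≤ p := dist_nonneg
  have hq : 0 ≤ q := dist_nonneg
  have hd0 : 0 ≤ d := dist_nonneg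
  obtain ⟨hQ, hfy⟩ := midpoint_estimate hk hkt ht.1.le hE0 hE hb ht3 hd0 htri hmid' i0 i1 hl ht2
  refine ⟨y, hy, (dist_comm x₀ y).trans_le (le_half_add_of_sq_add_sq_le hd0 hε.le htri hQ),
    le_half_add_of_sq_add_sq_le (a := q) (b := p) hd0 hε.le (by linarith) (by linarith), ?_⟩
  linarith

/-- Approximate convexity along approximate interpolants with dyadic parameter. -/
theorem exists_interpolant (H : RealFlow D f ℓ S) (hD : IsApproxLengthSubset D) {x₀ x₁ : X}
    (h₀ : x₀ ∈ D) (h₁ : x₁ ∈ D) (k : ℕ) {ε : ℝ} (hε : 0 < ε) :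
    ∃ y ∈ D, dist x₀ y ≤ (1 / 2) ^ k * dist x₀ x₁ + ε ∧
      dist y x₁ ≤ (1 - (1 / 2) ^ k) * dist x₀ x₁ + ε ∧
      f y ≤ (1 - (1 / 2) ^ k) * f x₀ + (1 / 2) ^ k * f x₁
        + ℓ / 2 * (1 / 2) ^ k * (1 - (1 / 2) ^ k) * dist x₀ x₁ ^ 2 + ε := by
  induction k generalizing ε with
  | zero => exact ⟨x₁, h₁, by simp [hε.le]⟩
  | succ k ih =>
    set d := dist x₀ x₁
    have hd : 0 ≤ d := dist_nonneg
    have hℓ := H.pos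
    -- `M` majorises the growth of the errors in one bisection.
    set M := 3 + ℓ * (2 * d + 1) with hM
    have hMpos : 0 < M := by positivity
    obtain ⟨δ, hδ, hδ1, hδM⟩ : ∃ δ : ℝ, 0 < δ ∧ δ ≤ 1 ∧ δ * M ≤ ε := by
      refine ⟨min 1 (ε / M), lt_min one_pos (div_pos hε hMpos), min_le_left _ _, ?_⟩
      rw [← le_div_iff₀ hMpos]; exact min_le_right _ _
    obtain ⟨y, hy, a1, a2, a3⟩ := ih hδ
    obtain ⟨z, hz, b1, b2, b3⟩ := H.exists_midpoint hD h₀ hy hδ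
    rw [show ((1 : ℝ) / 2) ^ (k + 1) = (1 / 2) ^ k / 2 by rw [pow_succ]; ring]
    have hs1 : ((1 : ℝ) / 2) ^ k ≤ 1 := pow_le_one₀ (by norm_num) (by norm_num)
    have hs0 : (0 : ℝ) < (1 / 2) ^ k := by positivity
    generalize ((1 : ℝ) / 2) ^ k = s at *
    have hM3 : 3 * δ ≤ ε := by nlinarith [mul_nonneg hδ.le (show 0 ≤ ℓ * (2 * d + 1) by positivity)]
    have tri := dist_triangle z y x₁
    refine ⟨z, hz, by linarith, by linarith, ?_⟩
    have c0 : 0 ≤ dist x₀ y := dist_nonneg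
    have c1 : dist x₀ y ^ 2 ≤ (s * d + δ) ^ 2 := by gcongr
    have c2 : (s * d + δ) ^ 2 ≤ s ^ 2 * d ^ 2 + δ * (2 * d + 1) := by
      nlinarith [mul_nonneg hδ.le hd, mul_nonneg (mul_nonneg hδ.le hd) (sub_nonneg.2 hs1)]
    have c3 : ℓ / 8 * dist x₀ y ^ 2 ≤ ℓ / 8 * (s ^ 2 * d ^ 2 + δ * (2 * d + 1)) := by
      gcongr; linarith
    have c4 : 0 ≤ ℓ * (2 * d + 1) * δ := by positivity
    have c5 : δ * M = 3 * δ + ℓ * (2 * d + 1) * δ := by rw [hM]; ring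
    nlinarith

/-- An interpolant at parameter s = 2^-k close to `x` lies in the ball where the local bound holds.
Convexity transfers that bound to `v` after division by s. -/
theorem hasSlopeBound_of_local (H : RealFlow D f ℓ S) (hD : IsApproxLengthSubset D) {x : X}
    (hx : x ∈ D) {G r : ℝ} (hr : 0 < r)
    (hloc : ∀ v ∈ D, dist x v < r → f x - f v ≤ G * dist x v) (hG : 0 ≤ G) :
    HasSlopeBound D f ℓ G x := by
  intro v hv
  set d := dist x v
  have hd : 0 ≤ d := dist_nonneg
  obtain ⟨k, hk⟩ := exists_pow_lt_of_lt_one (show 0 < r / (2 * (d + 1)) by positivity)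
    (show (1 : ℝ) / 2 < 1 by norm_num)
  have hs0 : (0 : ℝ) < (1 / 2) ^ k := by positivity
  have key := fun ε hε => H.exists_interpolant hD hx hv k (ε := ε) hε
  generalize ((1 : ℝ) / 2) ^ k = s at *
  have hsd : s * d < r / 2 := by
    rw [lt_div_iff₀ (by positivity)] at hk
    nlinarith
  have lim : s * (f x - f v) ≤ G * (s * d + 0) + ℓ / 2 * s * (1 - s) * d ^ 2 + 0 := by
    refine le_of_eventually_of_continuousAt
      (F := fun ε => G * (s * d + ε) + ℓ / 2 * s * (1 - s) * d ^ 2 + ε) (by fun_prop) ?_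
    filter_upwards [Ioo_mem_nhdsGT (show 0 < r / 2 by positivity)] with ε hε
    obtain ⟨y, hy, a1, -, a3⟩ := key ε hε.1
    have h1 := hloc y hy (by linarith [hε.2])
    have h2 := mul_le_mul_of_nonneg_left a1 hG
    linarith
  have h3 : s * (f x - f v) ≤ s * (G * d + ℓ / 2 * d ^ 2) := by
    have := H.pos
    have : 0 ≤ ℓ / 2 * s * s * d ^ 2 := by positivity
    nlinarith
  exact le_of_mul_le_mul_left h3 hs0

/-! ### Slope and energy estimates for the resolvent and the flow. -/

/-- Minimality of `z` is tested on interpolants from `z` towards `x`, at parameter s → 0. This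
doubles the coefficient 1/(2τ) given by `decrease`, which `resolvent_step` needs. -/
theorem resolvent_energy_drop (H : RealFlow D f ℓ S) (hD : IsApproxLengthSubset D) {x z : X}
    {τ η : ℝ} (hτ : 0 < τ) (hη : 0 ≤ η) (hx : x ∈ D) (hz : IsRealResolvent D f τ η x z) :
    (1 / τ - (ℓ + η) / 2) * dist x z ^ 2 ≤ f x - f z := by
  have key := fun k ε hε => H.exists_interpolant hD hz.mem hx k (ε := ε) hε
  rw [dist_comm z x] at key
  set d := dist x z with hd'
  have hd : 0 ≤ d := dist_nonneg
  have hstep : ∀ k : ℕ, d ^ 2 / τ ≤ f x - f z + ℓ / 2 * (1 - (1 / 2) ^ k) * d ^ 2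
      + η / 2 * d ^ 2 + (1 / 2) ^ k * (d ^ 2 / (2 * τ)) := by
    intro k
    have hs1 : ((1 : ℝ) / 2) ^ k ≤ 1 := pow_le_one₀ (by norm_num) (by norm_num)
    have hs0 : (0 : ℝ) < (1 / 2) ^ k := by positivity
    specialize key k
    generalize ((1 : ℝ) / 2) ^ k = s at *
    have lim := le_of_forall_pos_of_continuousAt (a := d ^ 2 / (2 * τ) + f z)
      (F := fun ε => ((1 - s) * d + ε) ^ 2 / (2 * τ) + ((1 - s) * f z + s * f x
        + ℓ / 2 * s * (1 - s) * d ^ 2 + ε) + η / 2 * d * (s * d + ε)) (by fun_prop) (by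
      intro ε hε
      obtain ⟨y, hy, a1, a2, a3⟩ := key ε hε
      have h1 := hz.minimal y hy
      rw [dist_comm y z, dist_comm x y, ← hd'] at h1
      refine h1.trans ?_
      gcongr)
    simp only [add_zero] at lim
    have e : d ^ 2 / τ = 2 * (d ^ 2 / (2 * τ)) := by field_simp
    have e2 : ((1 - s) * d) ^ 2 / (2 * τ) = (1 - s) ^ 2 * (d ^ 2 / (2 * τ)) := by ring
    rw [e2] at lim
    rw [e]
    generalize d ^ 2 / (2 * τ) = A at *
    refine le_of_mul_le_mul_left ?_ hs0
    nlinarith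
  have := le_of_forall_half_pow (F := fun s => f x - f z + ℓ / 2 * (1 - s) * d ^ 2
      + η / 2 * d ^ 2 + s * (d ^ 2 / (2 * τ))) (by fun_prop) hstep
  have e : 1 / τ * d ^ 2 = d ^ 2 / τ := by ring
  nlinarith

/-- The same variation, now from `z` towards an arbitrary `v`. -/
theorem resolvent_hasSlopeBound (H : RealFlow D f ℓ S) (hD : IsApproxLengthSubset D) {x z : X}
    {τ η : ℝ} (hτ : 0 < τ) (hη : 0 ≤ η) (hz : IsRealResolvent D f τ η x z) :
    HasSlopeBound D f ℓ (dist x z * (1 / τ + η / 2)) z := by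
  intro v hv
  have key := fun k ε hε => H.exists_interpolant hD hz.mem hv k (ε := ε) hε
  set d := dist z v with hd'
  set p := dist x z with hp'
  have hd : 0 ≤ d := dist_nonneg
  have hp : 0 ≤ p := dist_nonneg
  have hstep : ∀ k : ℕ, f z - f v ≤ p * d / τ + η / 2 * p * d
      + ℓ / 2 * (1 - (1 / 2) ^ k) * d ^ 2 + (1 / 2) ^ k * (d ^ 2 / (2 * τ)) := by
    intro k
    have hs1 : ((1 : ℝ) / 2) ^ k ≤ 1 := pow_le_one₀ (by norm_num) (by norm_num)
    have hs0 : (0 : ℝ) < (1 / 2) ^ k := by positivity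
    specialize key k
    generalize ((1 : ℝ) / 2) ^ k = s at *
    have lim := le_of_forall_pos_of_continuousAt (a := p ^ 2 / (2 * τ) + f z)
      (F := fun ε => (p + (s * d + ε)) ^ 2 / (2 * τ) + ((1 - s) * f z + s * f v
        + ℓ / 2 * s * (1 - s) * d ^ 2 + ε) + η / 2 * p * (s * d + ε)) (by fun_prop) (by
      intro ε hε
      obtain ⟨y, hy, a1, a2, a3⟩ := key ε hε
      have h1 := hz.minimal y hy
      have tri := dist_triangle x z y
      rw [dist_comm y z, ← hp'] at h1
      refine h1.trans ?_
      have : dist x y ≤ p + (s * d + ε) := by linarith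
      gcongr)
    simp only [add_zero] at lim
    have e2 : (p + s * d) ^ 2 / (2 * τ) = p ^ 2 / (2 * τ) + s * (p * d / τ)
        + s ^ 2 * (d ^ 2 / (2 * τ)) := by field_simp; ring
    rw [e2] at lim
    generalize d ^ 2 / (2 * τ) = A at *
    generalize p * d / τ = B at *
    refine le_of_mul_le_mul_left ?_ hs0
    nlinarith
  have := le_of_forall_half_pow (F := fun s => p * d / τ + η / 2 * p * d
      + ℓ / 2 * (1 - s) * d ^ 2 + s * (d ^ 2 / (2 * τ))) (by fun_prop) hstep
  have e : p * (1 / τ + η / 2) * d = p * d / τ + η / 2 * p * d := by ring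
  rw [e]
  simpa using this

/-- With v = x the EVI reads ρρ' ≤ ℓρ² + Gρ for ρ = d(S_r x, x), since the slope bound costs another
ℓρ²/2. The ε in the barrier keeps it positive and strict. -/
theorem dist_flow_le (H : RealFlow D f ℓ S) {x : X} (hx : x ∈ D) {G : ℝ} (hG0 : 0 ≤ G)
    (hG : HasSlopeBound D f ℓ G x) {t : ℝ} (ht : 0 ≤ t) :
    dist (S t x) x ≤ G * t * Real.exp (ℓ * t) := by
  have hℓ := H.pos
  have key : ∀ ε, 0 < ε → dist (S t x) x ≤ (ε + (G + ε) * t) * Real.exp (ℓ * t) := by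
    intro ε hε
    have h1 := H.compare hx hx ht
      (B := fun r => 1 / 2 * ((ε + (G + ε) * r) * Real.exp (ℓ * r)) ^ 2)
      (B' := fun r => 1 / 2 * ((2 : ℕ) * ((ε + (G + ε) * r) * Real.exp (ℓ * r)) ^ (2 - 1) *
        ((G + ε) * 1 * Real.exp (ℓ * r)
          + (ε + (G + ε) * r) * (Real.exp (ℓ * r) * (ℓ * 1)))))
      (fun r => (((((hasDerivAt_id r).const_mul (G + ε)).const_add ε).mul
        (((hasDerivAt_id r).const_mul ℓ).exp)).pow 2).const_mul (1 / 2)) ?_ ?_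
    · have h2 : dist (S t x) x ^ 2 ≤ ((ε + (G + ε) * t) * Real.exp (ℓ * t)) ^ 2 := by linarith
      exact (abs_le_of_sq_le_sq' h2 (by positivity)).2
    · simp; positivity
    · intro r hr heq
      have hr0 := hr.1
      set b := (ε + (G + ε) * r) * Real.exp (ℓ * r) with hb
      have hbpos : 0 < b := by positivity
      have hdb : dist (S r x) x = b := by
        have : dist (S r x) x ^ 2 = b ^ 2 := by linarith
        exact (pow_left_inj₀ dist_nonneg hbpos.le two_ne_zero).1 this
      have hsl := hG (S r x) (H.mem x hx r hr0.le)
      rw [dist_comm, hdb] at hsl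
      have he := one_le_exp_mul hℓ hr0.le
      have e : 1 / 2 * ((2 : ℕ) * b ^ (2 - 1) * ((G + ε) * 1 * Real.exp (ℓ * r)
          + (ε + (G + ε) * r) * (Real.exp (ℓ * r) * (ℓ * 1))))
          = b * ((G + ε) * Real.exp (ℓ * r)) + ℓ * b ^ 2 := by
        rw [hb]; push_cast; ring
      rw [e]
      have : b * G < b * ((G + ε) * Real.exp (ℓ * r)) := by
        refine mul_lt_mul_of_pos_left ?_ hbpos
        nlinarith
      nlinarith
  have := le_of_forall_pos_of_continuousAt
    (F := fun ε => (ε + (G + ε) * t) * Real.exp (ℓ * t)) (by fun_prop) key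
  simpa using this

theorem energy_drop_le (H : RealFlow D f ℓ S) {x : X} (hx : x ∈ D) {G : ℝ} (hG0 : 0 ≤ G)
    (hG : HasSlopeBound D f ℓ G x) {t : ℝ} (ht : 0 ≤ t) :
    f x - f (S t x) ≤ G ^ 2 * t * Real.exp (3 * ℓ * t) := by
  have h1 := H.dist_flow_le hx hG0 hG ht
  have h2 := hG (S t x) (H.mem x hx t ht)
  rw [dist_comm] at h2
  have hℓ := H.pos
  have he := one_le_exp_mul hℓ ht
  have he2 := Real.add_one_le_exp (ℓ * t)
  rw [show 3 * ℓ * t = ℓ * t + ℓ * t + ℓ * t by ring, Real.exp_add, Real.exp_add]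
  set E := Real.exp (ℓ * t)
  calc f x - f (S t x) ≤ G * (G * t * E) + ℓ / 2 * (G * t * E) ^ 2 := by
        refine h2.trans ?_
        gcongr
    _ = G ^ 2 * t * E * (1 + ℓ * t * E / 2) := by ring
    _ ≤ G ^ 2 * t * E * (E * E) := by
        refine mul_le_mul_of_nonneg_left ?_ (by positivity)
        nlinarith
    _ = _ := by ring

/-- One step comparison between the flow and an arbitrary point of smaller energy. -/
theorem dist_flow_sq_le (H : RealFlow D f ℓ S) {x z : X} (hx : x ∈ D) (hz : z ∈ D) {G : ℝ}
    (hG0 : 0 ≤ G) (hG : HasSlopeBound D f ℓ G x) (hzx : f z ≤ f x) {t : ℝ} (ht : 0 ≤ t) :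
    1 / 2 * dist (S t x) z ^ 2 ≤ Real.exp (ℓ * t) * (1 / 2 * dist x z ^ 2)
      - (f x - f z) * t + 1 / 2 * G ^ 2 * t ^ 2 * Real.exp (3 * ℓ * t) := by
  have hℓ := H.pos
  have key : ∀ ε, 0 < ε → 1 / 2 * dist (S t x) z ^ 2 ≤
      Real.exp (ℓ * t) * (1 / 2 * dist x z ^ 2 + ε + ε * t)
      - (f x - f z) * t + 1 / 2 * G ^ 2 * t ^ 2 * Real.exp (3 * ℓ * t) := by
    intro ε hε
    refine H.compare hx hz ht
      (B := fun r => Real.exp (ℓ * r) * (1 / 2 * dist x z ^ 2 + ε + ε * r)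
      - (f x - f z) * r + 1 / 2 * G ^ 2 * r ^ 2 * Real.exp (3 * ℓ * r))
      (B' := fun r => Real.exp (ℓ * r) * (ℓ * 1) * (1 / 2 * dist x z ^ 2 + ε + ε * r)
        + Real.exp (ℓ * r) * (ε * 1) - (f x - f z) * 1
        + (1 / 2 * G ^ 2 * ((2 : ℕ) * r ^ (2 - 1)) * Real.exp (3 * ℓ * r)
          + 1 / 2 * G ^ 2 * r ^ 2 * (Real.exp (3 * ℓ * r) * (3 * ℓ * 1))))
      (fun r => (((((hasDerivAt_id r).const_mul ℓ).exp).mul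
        (((hasDerivAt_id r).const_mul ε).const_add _)).sub
        ((hasDerivAt_id r).const_mul (f x - f z))).add
        (((hasDerivAt_pow 2 r).const_mul (1 / 2 * G ^ 2)).mul
          (((hasDerivAt_id r).const_mul (3 * ℓ)).exp))) ?_ ?_
    · simp; exact hε
    · intro r hr _
      have h1 := H.energy_drop_le hx hG0 hG hr.1.le
      have hr0 := hr.1
      have h2 : 0 < Real.exp (ℓ * r) * ε := by positivity
      have h3 : 0 ≤ ℓ * ((f x - f z) * r) :=
        mul_nonneg hℓ.le (mul_nonneg (by linarith) hr0.le)
      have h4 : 0 ≤ ℓ * G ^ 2 * r ^ 2 * Real.exp (3 * ℓ * r) := by positivity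
      push_cast
      simp only [pow_one]
      nlinarith
  have := le_of_forall_pos_of_continuousAt
    (F := fun ε => Real.exp (ℓ * t) * (1 / 2 * dist x z ^ 2 + ε + ε * t)
      - (f x - f z) * t + 1 / 2 * G ^ 2 * t ^ 2 * Real.exp (3 * ℓ * t)) (by fun_prop) key
  simpa using this

end RealFlow

end EVIFlow

/-! ### Numerical inequalities and Ekeland's principle. -/

namespace EVIFlow

theorem exp_le_one_add_two_mul {u : ℝ} (h0 : 0 ≤ u) (h1 : u ≤ 1 / 2) :
    Real.exp u ≤ 1 + 2 * u := by
  have h2 := Real.add_one_le_exp (-u)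
  have h3 : Real.exp (-u) * Real.exp u = 1 := by rw [← Real.exp_add]; simp
  have h4 := Real.exp_pos u
  have h5 : Real.exp u * (1 - u) ≤ (1 + 2 * u) * (1 - u) := by nlinarith
  exact le_of_mul_le_mul_right h5 (by linarith)

theorem step_estimate {a b c d e M R : ℝ} (ha : 0 ≤ a) (hb : 0 ≤ b) (hc : c = 6 * a + 3 * b)
    (hc1 : c ≤ 1 / 2) (hR : 1 + 4 * c ≤ R) (hM : 0 ≤ M)
    (h : e ^ 2 ≤ -(1 - (3 * a + b)) * d ^ 2 + (1 + 6 * a) * M) :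
    (d * (1 + b / 2)) ^ 2 + e ^ 2 ≤ R * M := by
  have hc0 : 0 ≤ c := by rw [hc]; positivity
  have h4 : (1 - c) * (1 + b / 2) ^ 2 ≤ 1 - (3 * a + b) := by
    have h1 : (1 + b / 2) ^ 2 ≤ 1 + 2 * b := by nlinarith
    have h2 := mul_le_mul_of_nonneg_left h1 (show 0 ≤ 1 - c by linarith)
    have h3 : 0 ≤ c * b := by positivity
    linarith
  have h5 := mul_le_mul_of_nonneg_right h4 (sq_nonneg d)
  have h6 : (1 - c) * ((d * (1 + b / 2)) ^ 2 + e ^ 2) ≤ (1 + c) * M := by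
    have h1 : (1 + 6 * a) * M ≤ (1 + c) * M := by gcongr; linarith
    have h2 : 0 ≤ c * e ^ 2 := by positivity
    linarith
  have h7 : 1 + c ≤ (1 - c) * R := by
    have h1 := mul_le_mul_of_nonneg_left hR (show 0 ≤ 1 - c by linarith)
    nlinarith
  refine le_of_mul_le_mul_left (a := 1 - c) ?_ (by linarith)
  linarith [mul_le_mul_of_nonneg_right h7 hM]

/-- Ekeland's variational principle for a function with complete sublevels on `D`. -/
theorem exists_ekeland_point {X : Type*} [MetricSpace X] {D : Set X} {g : X → ℝ}
    (hg : ∀ c : ℝ, IsComplete {x | x ∈ D ∧ g x ≤ c}) {m : ℝ} (hm : ∀ x ∈ D, m ≤ g x)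
    {α : ℝ} (hα : 0 < α) {z₀ : X} (hz₀ : z₀ ∈ D) :
    ∃ z ∈ D, g z ≤ g z₀ ∧ ∀ v ∈ D, g z ≤ g v + α * dist z v := by
  have hnext : ∀ z : D, ∃ w : D, g w + α * dist (z : X) w ≤ g z ∧
      ∀ v ∈ D, g v + α * dist (z : X) v ≤ g z → g w ≤ (g z + g v) / 2 := by
    intro z
    set A := g '' {v | v ∈ D ∧ g v + α * dist (z : X) v ≤ g z}
    have hne : A.Nonempty := ⟨g z, z, ⟨z.2, by simp⟩, rfl⟩
    have hbdd : BddBelow A := ⟨m, by rintro _ ⟨v, hv, rfl⟩; exact hm v hv.1⟩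
    -- The successor of `z` at least halves the gap between `g z` and the infimum over its
    -- admissible set.
    have hI : ∀ v ∈ D, g v + α * dist (z : X) v ≤ g z → sInf A ≤ g v := fun v hv h =>
      csInf_le hbdd ⟨v, ⟨hv, h⟩, rfl⟩
    have hIz := hI z z.2 (by simp)
    rcases hIz.eq_or_lt with h | h
    · exact ⟨z, by simp, fun v hv hvz => by linarith [hI v hv hvz]⟩
    · obtain ⟨_, ⟨w, hw, rfl⟩, hwlt⟩ := exists_lt_of_csInf_lt hne
        (show sInf A < (g z + sInf A) / 2 by linarith)
      exact ⟨⟨w, hw.1⟩, hw.2, fun v hv hvz => by linarith [hI v hv hvz]⟩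
  choose next hn1 hn2 using hnext
  set s : ℕ → D := fun n => next^[n] ⟨z₀, hz₀⟩ with hs
  have hss : ∀ n, s (n + 1) = next (s n) := fun n => Function.iterate_succ_apply' next n _
  have hdist : ∀ n k, α * dist (s n : X) (s (n + k)) ≤ g (s n) - g (s (n + k)) := by
    intro n k
    induction k with
    | zero => simp
    | succ k ih =>
      have h1 := hn1 (s (n + k))
      rw [← hss] at h1
      have h2 := dist_triangle (s n : X) (s (n + k)) (s (n + k + 1))
      rw [← add_assoc]
      nlinarith
  have hanti : Antitone fun n => g (s n) := antitone_nat_of_succ_le fun n => by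
    have h1 := hdist n 1
    have : 0 ≤ α * dist (s n : X) (s (n + 1)) := by positivity
    linarith
  have hbdd : BddBelow (range fun n => g (s n)) := ⟨m, by rintro _ ⟨n, rfl⟩; exact hm _ (s n).2⟩
  set L := ⨅ n, g (s n) with hL
  have hlim : Tendsto (fun n => g (s n)) atTop (𝓝 L) := tendsto_atTop_ciInf hanti hbdd
  have hLle : ∀ n, L ≤ g (s n) := fun n => ciInf_le hbdd n
  have hd : ∀ n k, n ≤ k → dist (s n : X) (s k) ≤ (g (s n) - L) / α := by
    intro n k hnk
    obtain ⟨j, rfl⟩ := Nat.exists_eq_add_of_le hnk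
    rw [le_div_iff₀ hα]
    linarith [hdist n j, hLle (n + j)]
  have hcau : CauchySeq fun n => (s n : X) := by
    refine cauchySeq_of_le_tendsto_0' (fun n => (g (s n) - L) / α) hd ?_
    simpa using (hlim.sub_const L).div_const α
  have hs0 : (s 0 : X) = z₀ := rfl
  obtain ⟨z, hz, hzlim⟩ := cauchySeq_tendsto_of_isComplete (hg (g z₀))
    (fun n => ⟨(s n).2, by simpa [hs0] using hanti (Nat.zero_le n)⟩) hcau
  have hzs : ∀ n, g z ≤ g (s n) := fun n =>
    ((hg (g (s n))).isClosed.mem_of_tendsto hzlim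
      (eventually_ge_atTop n |>.mono fun k hk => ⟨(s k).2, hanti hk⟩)).2
  have hzL : g z ≤ L := le_ciInf hzs
  refine ⟨z, hz.1, hz.2, fun v hv => ?_⟩
  by_contra! hlt
  have hdz : ∀ n, α * dist (s n : X) z ≤ g (s n) - L := by
    intro n
    have h1 : dist (s n : X) z ≤ (g (s n) - L) / α :=
      le_of_tendsto (tendsto_const_nhds.dist hzlim)
        (eventually_ge_atTop n |>.mono fun k hk => hd n k hk)
    rw [le_div_iff₀ hα] at h1
    linarith
  -- A violating `v` is admissible for every iterate, because `s n` precedes `z` and `z` precedes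
  -- `v`. Halving then forces `L ≤ g v`, against `g v < g z ≤ L`.
  have hv2 : ∀ n, g (s (n + 1)) ≤ (g (s n) + g v) / 2 := by
    intro n
    rw [hss]
    refine hn2 (s n) v hv ?_
    have := dist_triangle (s n : X) z v
    nlinarith [hdz n]
  have h1 : L ≤ (L + g v) / 2 :=
    le_of_tendsto_of_tendsto' (hlim.comp (tendsto_add_atTop_nat 1))
      ((hlim.add_const (g v)).div_const 2) hv2
  have : 0 ≤ α * dist z v := by positivity
  linarith

/-! ### Error estimate, convergence and existence of discrete movements. -/

namespace RealFlow

variable {X : Type*} [MetricSpace X] {D : Set X} {f : X → ℝ} {ℓ : ℝ} {S : ℝ → X → X}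

/-- In `dist_flow_sq_le` the distance term contributes about d² to the squared error, while twice
the energy drop removes about 2d². The remaining -d² pays for the new slope, about d/τ. -/
theorem resolvent_step (H : RealFlow D f ℓ S) (hD : IsApproxLengthSubset D) {x z : X}
    {τ η G : ℝ} (hτ : 0 < τ) (hη : 0 ≤ η) (hsmall : (6 * ℓ + 3 * η) * τ ≤ 1 / 2) (hx : x ∈ D)
    (hz : IsRealResolvent D f τ η x z) (hG0 : 0 ≤ G) (hG : HasSlopeBound D f ℓ G x) :
    (dist x z * (1 / τ + η / 2)) ^ 2 + (dist (S τ x) z / τ) ^ 2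
      ≤ Real.exp (4 * ((6 * ℓ + 3 * η) * τ)) * G ^ 2 := by
  have hℓ := H.pos
  have hdec : f z ≤ f x := by
    have := hz.decrease
    have : 0 ≤ dist x z ^ 2 / (2 * τ) := by positivity
    linarith
  have h1 := H.dist_flow_sq_le hx hz.mem hG0 hG hdec hτ.le
  have h2 := H.resolvent_energy_drop hD hτ hη hx hz
  have hℓτ : 0 ≤ ℓ * τ := by positivity
  have hητ : 0 ≤ η * τ := by positivity
  have e1 := exp_le_one_add_two_mul hℓτ (by nlinarith)
  have e3 := exp_le_one_add_two_mul (u := 3 * ℓ * τ) (by positivity) (by nlinarith)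
  have e4 := Real.add_one_le_exp (4 * ((6 * ℓ + 3 * η) * τ))
  set e := dist (S τ x) z
  set d := dist x z
  have h2' : (1 - (ℓ * τ + η * τ) / 2) * d ^ 2 ≤ (f x - f z) * τ := by
    calc _ = (1 / τ - (ℓ + η) / 2) * d ^ 2 * τ := by field_simp
      _ ≤ _ := by gcongr
  have hG' : (d * (1 / τ + η / 2)) = d * (1 + η * τ / 2) / τ := by field_simp
  rw [hG', div_pow, div_pow, ← add_div, div_le_iff₀ (by positivity)]
  have h3 : e ^ 2 ≤ -(1 - (3 * (ℓ * τ) + η * τ)) * d ^ 2 + (1 + 6 * (ℓ * τ)) * (G ^ 2 * τ ^ 2) := by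
    have c1 := mul_le_mul_of_nonneg_right e1 (sq_nonneg d)
    have c2 := mul_le_mul_of_nonneg_right e3 (show 0 ≤ G ^ 2 * τ ^ 2 by positivity)
    nlinarith
  set c := (6 * ℓ + 3 * η) * τ with hc
  have hc' : c = 6 * (ℓ * τ) + 3 * (η * τ) := by rw [hc]; ring
  have := step_estimate hℓτ hητ hc' hsmall (by linarith) (show 0 ≤ G ^ 2 * τ ^ 2 by positivity) h3
  linarith

theorem discrete_error (H : RealFlow D f ℓ S) (hD : IsApproxLengthSubset D) {u₀ : X}
    {τ η G : ℝ} (hτ : 0 < τ) (hη : 0 ≤ η) (hsmall : (6 * ℓ + 3 * η) * τ ≤ 1 / 2) (hu₀ : u₀ ∈ D)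
    (hG0 : 0 ≤ G) (hG : HasSlopeBound D f ℓ G u₀) {U : ℕ → X} (hU0 : U 0 = u₀)
    (hU : ∀ n, IsRealResolvent D f τ η (U n) (U (n + 1))) (n : ℕ) :
    dist (S (n * τ) u₀) (U n) ^ 2 ≤
      Real.exp (ℓ * (n * τ)) ^ 2 * Real.exp (4 * ((6 * ℓ + 3 * η) * (n * τ))) * G ^ 2
        * (n * τ) * τ := by
  have hℓ := H.pos
  have hUD : ∀ n, U n ∈ D := fun n => by
    cases n with
    | zero => rwa [hU0]
    | succ n => exact (hU n).mem
  have hτ' : 0 ≤ 1 / τ + η / 2 := by positivity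
  set e : ℕ → ℝ := fun i => dist (S τ (U i)) (U (i + 1)) with he
  set ρ := Real.exp (4 * ((6 * ℓ + 3 * η) * τ)) with hρ
  have hρ1 : 1 ≤ ρ := Real.one_le_exp (by positivity)
  -- The slope bound `g` at the current point is carried along, so that `resolvent_step` can be
  -- iterated.
  have hsum : ∀ n, ∃ g, 0 ≤ g ∧ HasSlopeBound D f ℓ g (U n) ∧
      g ^ 2 + ∑ i ∈ Finset.range n, (e i / τ) ^ 2 ≤ ρ ^ n * G ^ 2 := by
    intro n
    induction n with
    | zero => exact ⟨G, hG0, by rwa [hU0], by simp⟩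
    | succ n ih =>
      obtain ⟨g, hg0, hg, hle⟩ := ih
      refine ⟨_, mul_nonneg dist_nonneg hτ', H.resolvent_hasSlopeBound hD hτ hη (hU n), ?_⟩
      have h1 := H.resolvent_step hD hτ hη hsmall (hUD n) (hU n) hg0 hg
      have h2 : 0 ≤ ∑ i ∈ Finset.range n, (e i / τ) ^ 2 :=
        Finset.sum_nonneg fun i _ => sq_nonneg _
      have h3 := mul_le_mul_of_nonneg_left hle (zero_le_one.trans hρ1)
      have h4 := mul_le_mul_of_nonneg_right hρ1 h2
      rw [Finset.sum_range_succ, pow_succ ρ n]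
      linarith
  have hdist : ∀ n : ℕ, dist (S (n * τ) u₀) (U n) ≤
      Real.exp (ℓ * (n * τ)) * ∑ i ∈ Finset.range n, e i := by
    intro n
    induction n with
    | zero => simp [H.zero u₀ hu₀, hU0]
    | succ n ih =>
      have hn : 0 ≤ (n : ℝ) * τ := by positivity
      push_cast
      rw [show ((n : ℝ) + 1) * τ = n * τ + τ by ring, H.semigroup u₀ hu₀ _ _ hn hτ.le,
        Finset.sum_range_succ]
      have h1 := dist_triangle (S τ (S (n * τ) u₀)) (S τ (U n)) (U (n + 1))
      have h2 := H.contraction (H.mem u₀ hu₀ _ hn) (hUD n) hτ.le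
      have h3 := mul_le_mul_of_nonneg_left ih (Real.exp_pos (ℓ * τ)).le
      have h4 : 1 ≤ Real.exp (ℓ * (n * τ + τ)) := one_le_exp_mul hℓ (by positivity)
      have h5 : Real.exp (ℓ * (n * τ + τ)) = Real.exp (ℓ * τ) * Real.exp (ℓ * (n * τ)) := by
        rw [← Real.exp_add]; ring_nf
      have h6 : 0 ≤ e n := dist_nonneg
      rw [mul_add, h5, mul_assoc]
      rw [h5] at h4
      have h7 : e n ≤ Real.exp (ℓ * τ) * Real.exp (ℓ * (n * τ)) * e n := by nlinarith
      linarith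
  obtain ⟨g, -, -, hg⟩ := hsum n
  have hS : ∑ i ∈ Finset.range n, e i ^ 2 ≤ τ ^ 2 * (ρ ^ n * G ^ 2) := by
    have : ∑ i ∈ Finset.range n, e i ^ 2 = τ ^ 2 * ∑ i ∈ Finset.range n, (e i / τ) ^ 2 := by
      rw [Finset.mul_sum]
      refine Finset.sum_congr rfl fun i _ => ?_
      field_simp
    rw [this]
    have := sq_nonneg g
    gcongr
    linarith
  have hCS := sq_sum_le_card_mul_sum_sq (s := Finset.range n) (f := e)
  rw [Finset.card_range] at hCS
  have hρn : ρ ^ n = Real.exp (4 * ((6 * ℓ + 3 * η) * (n * τ))) := by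
    rw [hρ, ← Real.exp_nat_mul]; ring_nf
  calc _ ≤ (Real.exp (ℓ * (n * τ)) * ∑ i ∈ Finset.range n, e i) ^ 2 := by
        gcongr; exact hdist n
    _ = Real.exp (ℓ * (n * τ)) ^ 2 * (∑ i ∈ Finset.range n, e i) ^ 2 := by ring
    _ ≤ Real.exp (ℓ * (n * τ)) ^ 2 * (n * (τ ^ 2 * (ρ ^ n * G ^ 2))) := by
        gcongr
        exact hCS.trans (by gcongr)
    _ = _ := by rw [hρn]; ring

/-- Discrete minimizing movements converge to the flow as the step tends to zero. -/
theorem discrete_convergence (H : RealFlow D f ℓ S) (hD : IsApproxLengthSubset D) {u₀ : X}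
    {η G : ℝ} (hη : 0 ≤ η) (hu₀ : u₀ ∈ D) (hG0 : 0 ≤ G) (hG : HasSlopeBound D f ℓ G u₀)
    {t : ℝ} (ht : 0 ≤ t) {ε : ℝ} (hε : 0 < ε) :
    ∃ τ₀, 0 < τ₀ ∧ ∀ τ ∈ Ioo 0 τ₀, ∀ U : ℕ → X, U 0 = u₀ →
      (∀ n, IsRealResolvent D f τ η (U n) (U (n + 1))) →
      dist (U ⌈t / τ⌉₊) (S t u₀) < ε := by
  have hℓ := H.pos
  obtain ⟨δ, hδ, hcont⟩ := Metric.continuousWithinAt_iff.1 (H.cont u₀ hu₀ t ht) (ε / 2)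
    (by positivity)
  set C := 6 * ℓ + 3 * η with hC
  have hCpos : 0 < C := by positivity
  set K := Real.exp (ℓ * (t + 1)) ^ 2 * Real.exp (4 * (C * (t + 1))) * G ^ 2 * (t + 1) with hK
  have hK0 : 0 ≤ K := by positivity
  -- 1 keeps the grid time below t + 1, δ uses continuity of the flow between t and the grid time,
  -- and the last two give the smallness condition and an error below ε/2.
  refine ⟨min (min 1 δ) (min (1 / (2 * C)) ((ε / 2) ^ 2 / (K + 1))), by positivity, ?_⟩
  intro τ hτ U hU0 hU
  obtain ⟨hτ0, hτ1⟩ := hτ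
  simp only [lt_min_iff] at hτ1
  obtain ⟨⟨hτ1, hτδ⟩, hτC, hτK⟩ := hτ1
  have hsmall : C * τ ≤ 1 / 2 := by
    rw [lt_div_iff₀ (by positivity)] at hτC; linarith
  have herr := H.discrete_error hD hτ0 hη hsmall hu₀ hG0 hG hU0 hU ⌈t / τ⌉₊
  have hn1 : t ≤ ⌈t / τ⌉₊ * τ := by
    have := Nat.le_ceil (t / τ)
    rwa [div_le_iff₀ hτ0] at this
  have hn2 : ⌈t / τ⌉₊ * τ < t + τ := by
    have := Nat.ceil_lt_add_one (div_nonneg ht hτ0.le)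
    calc _ < (t / τ + 1) * τ := by gcongr
      _ = _ := by field_simp
  set s := (⌈t / τ⌉₊ : ℝ) * τ
  have hs0 : 0 ≤ s := ht.trans hn1
  have hs1 : s ≤ t + 1 := by linarith
  have h1 : dist (S s u₀) (U ⌈t / τ⌉₊) < ε / 2 := by
    refine lt_of_pow_lt_pow_left₀ 2 (by positivity) ?_
    calc _ ≤ _ := herr
      _ ≤ K * τ := by rw [hK]; gcongr
      _ < (ε / 2) ^ 2 := by
        rw [lt_div_iff₀ (by positivity)] at hτK
        linarith
  have h2 : dist (S s u₀) (S t u₀) < ε / 2 := hcont hs0 (by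
    rw [Real.dist_eq, abs_of_nonneg (by linarith)]; linarith)
  have h3 := dist_triangle_left (U ⌈t / τ⌉₊) (S t u₀) (S s u₀)
  linarith

/-- If `x` does not minimise the penalised energy, points of lower penalised energy stay at distance
at least r from `x`. Ekeland's principle with slope ηr/2 then yields the relaxed inequality, as r ≤
d(x, z). -/
theorem exists_resolvent (H : RealFlow D f ℓ S)
    (hc : ∀ c : ℝ, IsComplete {x | x ∈ D ∧ f x ≤ c}) {η : ℝ} (hη : 0 < η) (hne : D.Nonempty) :
    ∃ τ₀, 0 < τ₀ ∧ ∀ τ ∈ Ioo 0 τ₀, ∀ x ∈ D, ∃ z, IsRealResolvent D f τ η x z := by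
  obtain ⟨w, hw⟩ := hne
  obtain ⟨a, b, ha, hb, hlow⟩ := H.exists_quadratic_lower_bound hw
  -- For such τ the penalty dominates the quadratic lower bound of `f`, even after recentring from
  -- `w` to `x`.
  refine ⟨1 / (4 * (b + 1)), by positivity, fun τ hτ x hx => ?_⟩
  obtain ⟨hτ0, hτb⟩ := hτ
  have hcoef : 2 * b ≤ 1 / (2 * τ) := by
    rw [lt_div_iff₀ (by positivity)] at hτb
    rw [le_div_iff₀ (by positivity)]
    nlinarith
  set g : X → ℝ := fun v => dist x v ^ 2 / (2 * τ) + f v with hg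
  have hpen : ∀ v, 0 ≤ dist x v ^ 2 / (2 * τ) := fun v => by positivity
  have hgx : g x = f x := by simp [hg]
  have hm : ∀ v ∈ D, -a - 2 * b * dist w x ^ 2 ≤ g v := by
    intro v hv
    have h1 := hlow v hv
    have h2 : dist w v ^ 2 ≤ 2 * dist w x ^ 2 + 2 * dist x v ^ 2 := by
      have h3 := dist_triangle w x v
      have h4 : dist w v ^ 2 ≤ (dist w x + dist x v) ^ 2 := by gcongr
      nlinarith [sq_nonneg (dist w x - dist x v)]
    have h5 : 2 * b * dist x v ^ 2 ≤ dist x v ^ 2 / (2 * τ) := by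
      rw [div_eq_mul_one_div, mul_comm (dist x v ^ 2)]
      gcongr
    have h6 := mul_le_mul_of_nonneg_left h2 hb
    simp only [hg]
    linarith
  have hgc : ∀ c : ℝ, IsComplete {v | v ∈ D ∧ g v ≤ c} := by
    intro c F hF hFs
    have hev : ∀ᶠ v in F, v ∈ D ∧ g v ≤ c := le_principal_iff.1 hFs
    have hevf : ∀ᶠ v in F, v ∈ D ∧ f v ≤ c := hev.mono fun v hv =>
      ⟨hv.1, by linarith [hpen v, hv.2]⟩
    obtain ⟨y, hy, hFy⟩ := hc c F hF (le_principal_iff.2 hevf)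
    have := hF.1
    refine ⟨y, ⟨hy.1, ?_⟩, hFy⟩
    refine le_of_forall_pos_le_add fun ε hε => ?_
    have hcont : Tendsto (fun v => dist x v ^ 2 / (2 * τ)) F (𝓝 (dist x y ^ 2 / (2 * τ))) :=
      (Continuous.tendsto (by fun_prop) y).mono_left hFy
    have hev2 : ∀ᶠ v in F, v ∈ {v | v ∈ D ∧ f v ≤ c + ε - dist x y ^ 2 / (2 * τ)} := by
      filter_upwards [hev, hcont.eventually_const_lt (sub_lt_self _ hε)] with v hv hv2
      exact ⟨hv.1, by linarith [hv.2]⟩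
    have := ((H.closed _).mem_of_tendsto (f := id) hFy hev2).2
    simp only [hg] at this ⊢
    linarith
  by_cases hmin : ∀ v ∈ D, g x ≤ g v
  · refine ⟨x, hx, fun y hy => ?_, by simp⟩
    have := hmin y hy
    simp only [hg] at this
    simpa using this
  · push Not at hmin
    obtain ⟨z₀, hz₀, hlt⟩ := hmin
    have hopen : {v | v ∈ D ∧ f v ≤ g z₀}ᶜ ∈ 𝓝 x :=
      (H.closed (g z₀)).isOpen_compl.mem_nhds fun h => by linarith [h.2]
    obtain ⟨r, hr, hball⟩ := Metric.mem_nhds_iff.1 hopen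
    obtain ⟨z, hz, hz1, hz2⟩ := exists_ekeland_point hgc hm (α := η / 2 * r) (by positivity) hz₀
    have hrz : r ≤ dist x z := by
      by_contra! hlt
      exact hball (by rwa [Metric.mem_ball, dist_comm]) ⟨hz, by linarith [hpen z]⟩
    refine ⟨z, hz, fun y hy => ?_, by linarith⟩
    refine (hz2 y hy).trans ?_
    rw [dist_comm z y]
    gcongr

end RealFlow

end EVIFlow

/-! ### Passage from extended-real to real-valued energies. -/

namespace EVIFlow

variable {X : Type*}

theorem coe_toReal_of_mem_dom {φ : X → EReal} (hφ : IsProper φ) {x : X} (hx : x ∈ Dom φ) :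
    (((φ x).toReal : ℝ) : EReal) = φ x :=
  EReal.coe_toReal (ne_of_lt hx) (hφ.1 x)

theorem sublevel_eq {φ : X → EReal} (hφ : IsProper φ) (c : ℝ) :
    {x | x ∈ Dom φ ∧ (φ x).toReal ≤ c} = {x | φ x ≤ (c : EReal)} := by
  ext x
  refine ⟨fun ⟨hx, hc⟩ => ?_, fun h => ?_⟩
  · rw [mem_ofPred_eq, ← coe_toReal_of_mem_dom hφ hx]
    exact_mod_cast hc
  · have hx : x ∈ Dom φ := lt_of_le_of_lt h (EReal.coe_lt_top c)
    refine ⟨hx, ?_⟩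
    rw [mem_ofPred_eq, ← coe_toReal_of_mem_dom hφ hx] at h
    exact_mod_cast h

variable [MetricSpace X]

theorem isComplete_sublevel {φ : X → EReal} (hφ : IsProper φ) (hc : HasCompleteSublevels φ)
    (c : ℝ) : IsComplete {x | x ∈ Dom φ ∧ (φ x).toReal ≤ c} := by
  rw [sublevel_eq hφ]
  exact hc c

/-- Replacing `-lam` by `max 1 (-lam)` only weakens the EVI and makes the constant positive, as
division by ℓ in `expKernel` requires. -/
theorem IsEVIGradientFlow.realFlow {φ : X → EReal} (hφ : IsProper φ)
    (hc : HasCompleteSublevels φ) {lam : ℝ} {S : ℝ → X → X}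
    (hS : IsEVIGradientFlow φ lam (closure (Dom φ)) S) :
    RealFlow (Dom φ) (fun x => (φ x).toReal) (max 1 (-lam)) S where
  pos := lt_max_of_lt_left one_pos
  mem x hx t ht := by
    rcases ht.eq_or_lt with rfl | ht
    · rwa [hS.zero x (_root_.subset_closure hx)]
    · exact (hS.isSolution x (_root_.subset_closure hx)).mem_dom t ht
  zero x hx := hS.zero x (_root_.subset_closure hx)
  semigroup x hx := hS.semigroup x (_root_.subset_closure hx)
  cont x hx t ht := by
    rcases (mem_Ici.1 ht).eq_or_lt with rfl | ht
    · have h := hS.tendsto_zero x (_root_.subset_closure hx)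
      rw [← continuousWithinAt_Ioi_iff_Ici]
      simpa [ContinuousWithinAt, hS.zero x (_root_.subset_closure hx)] using h
    · exact ((hS.isSolution x (_root_.subset_closure hx)).continuousOn.continuousAt
        (Ioi_mem_nhds ht)).continuousWithinAt
  closed c := (isComplete_sublevel hφ hc c).isClosed
  evi x hx t ht v hv c hlt := by
    have hsol := hS.isSolution x (_root_.subset_closure hx)
    have h := hsol.evi t ht v hv
    rw [← coe_toReal_of_mem_dom hφ hv, ← coe_toReal_of_mem_dom hφ (hsol.mem_dom t ht)] at h
    have hL : upperRightDeriv (fun s => (1 / 2) * dist (S s x) v ^ 2) t < (c : EReal) := by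
      by_contra! hcl
      have h2 := (add_le_add_left hcl _).trans h
      norm_cast at h2
      have h3 := mul_le_mul_of_nonneg_right (le_max_right 1 (-lam)) (sq_nonneg (dist (S t x) v))
      linarith
    filter_upwards [eventually_lt_of_limsup_lt hL] with h hh
    exact_mod_cast hh

theorem mem_ekelandResolvent_iff {φ : X → EReal} (hφ : IsProper φ) {τ η : ℝ} {x z : X}
    (hx : x ∈ Dom φ) : z ∈ ekelandResolvent φ τ η x ↔
      IsRealResolvent (Dom φ) (fun x => (φ x).toReal) τ η x z := by
  constructor
  · rintro ⟨hz, hmin, hdec⟩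
    rw [← coe_toReal_of_mem_dom hφ hz, ← coe_toReal_of_mem_dom hφ hx] at hdec
    refine ⟨hz, fun y hy => ?_, by exact_mod_cast hdec⟩
    have h := hmin y
    rw [← coe_toReal_of_mem_dom hφ hz, ← coe_toReal_of_mem_dom hφ hy] at h
    exact_mod_cast h
  · rintro ⟨hz, hmin, hdec⟩
    refine ⟨hz, fun y => ?_, ?_⟩
    · by_cases hy : y ∈ Dom φ
      · rw [← coe_toReal_of_mem_dom hφ hz, ← coe_toReal_of_mem_dom hφ hy]
        exact_mod_cast hmin y hy
      · have : φ y = ⊤ := not_lt_top_iff.1 hy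
        rw [this, EReal.coe_add_top, EReal.top_add_coe]
        exact le_top
    · rw [← coe_toReal_of_mem_dom hφ hz, ← coe_toReal_of_mem_dom hφ hx]
      exact_mod_cast hdec

theorem mem_dom_of_metricSlope_lt_top {φ : X → EReal} {x : X} (h : metricSlope φ x < ⊤) :
    x ∈ Dom φ := by
  by_contra hx
  simp [metricSlope, hx] at h

theorem exists_local_slope_bound {φ : X → EReal} (hφ : IsProper φ) {x : X}
    (h : metricSlope φ x < ⊤) : ∃ G : ℝ, 0 ≤ G ∧ ∃ r, 0 < r ∧ ∀ v ∈ Dom φ, dist x v < r →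
      (φ x).toReal - (φ v).toReal ≤ G * dist x v := by
  have hx := mem_dom_of_metricSlope_lt_top h
  obtain ⟨G, hG, -⟩ := ENNReal.lt_iff_exists_nnreal_btwn.1 h
  rw [metricSlope, if_pos hx] at hG
  have hev := eventually_lt_of_limsup_lt hG
  rw [eventually_nhdsWithin_iff] at hev
  obtain ⟨r, hr, hball⟩ := Metric.eventually_nhds_iff.1 hev
  refine ⟨G, G.2, r, hr, fun v hv hvr => ?_⟩
  rcases eq_or_ne v x with rfl | hne
  · simp
  have h1 := (hball (by rwa [dist_comm]) hne).le
  rw [ENNReal.div_le_iff (by simpa using hne.symm) (edist_ne_top x v),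
    ← coe_toReal_of_mem_dom hφ hx, ← coe_toReal_of_mem_dom hφ hv, ← EReal.coe_sub,
    EReal.toENNReal_of_ne_top (EReal.coe_ne_top _), EReal.toReal_coe, edist_dist,
    ← ENNReal.ofReal_coe_nnreal, ← ENNReal.ofReal_mul (p := (G : ℝ)) G.2] at h1
  exact (ENNReal.ofReal_le_ofReal_iff (by positivity)).1 h1

theorem exists_discreteMM {φ : X → EReal} {τ η : ℝ}
    (h : ∀ x ∈ Dom φ, ∃ z, z ∈ ekelandResolvent φ τ η x) {u₀ : X} (hu₀ : u₀ ∈ Dom φ) :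
    ∃ U, U ∈ discreteMM φ τ η u₀ := by
  have h' : ∀ x : Dom φ, ∃ z : Dom φ, (z : X) ∈ ekelandResolvent φ τ η x := fun x => by
    obtain ⟨z, hz⟩ := h x x.2
    exact ⟨⟨z, hz.1⟩, hz⟩
  choose next hnext using h'
  refine ⟨fun n => next^[n] ⟨u₀, hu₀⟩, rfl, fun n => Subtype.coe_prop _, fun n => ?_⟩
  simp only [Function.iterate_succ_apply']
  exact hnext _

end EVIFlow

/-! ### Identification of the limits. -/

open EVIFlow in
theorem corollary5p7 {X : Type*} [MetricSpace X] (φ : X → EReal) (hφ : IsProper φ)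
    (hcomplete : HasCompleteSublevels φ) (hlength : IsApproxLengthSubset (Dom φ))
    (lam : ℝ) (hlam : lam ≤ 0) (S : ℝ → X → X)
    (hS : IsEVIGradientFlow φ lam (closure (Dom φ)) S)
    (u₀ : X) (hu₀ : metricSlope φ u₀ < ⊤) :
    generalizedMinimizingMovements φ u₀ = minimizingMovements φ u₀ ∧
      minimizingMovements φ u₀ = {fun t : ℝ≥0 => S t u₀} := by
  have H := hS.realFlow hφ hcomplete
  have hu₀D := mem_dom_of_metricSlope_lt_top hu₀
  obtain ⟨G, hG0, r, hr, hloc⟩ := exists_local_slope_bound hφ hu₀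
  have hG := H.hasSlopeBound_of_local hlength hu₀D hr hloc hG0
  have hconv : ∀ η : ℝ, 0 ≤ η → ∀ t : ℝ≥0, ∀ ε : ℝ, 0 < ε → ∃ τ₀ : ℝ, 0 < τ₀ ∧
      ∀ τ ∈ Ioo 0 τ₀, ∀ U ∈ discreteMM φ τ η u₀, dist (interpolant τ U t) (S t u₀) < ε := by
    intro η hη t ε hε
    obtain ⟨τ₀, hτ₀, h⟩ := H.discrete_convergence hlength hη hu₀D hG0 hG t.2 hε
    exact ⟨τ₀, hτ₀, fun τ hτ U hU => h τ hτ U hU.1 fun n =>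
      (mem_ekelandResolvent_iff hφ (hU.2.1 n)).1 (hU.2.2 n)⟩
  obtain ⟨τ₀, hτ₀, hres⟩ := H.exists_resolvent (isComplete_sublevel hφ hcomplete) one_pos
    ⟨u₀, hu₀D⟩
  have hex : ∀ τ ∈ Ioo 0 τ₀, ∃ U, U ∈ discreteMM φ τ 1 u₀ := fun τ hτ =>
    exists_discreteMM (fun x hx => by
      obtain ⟨z, hz⟩ := hres τ hτ x hx
      exact ⟨z, (mem_ekelandResolvent_iff hφ hx).2 hz⟩) hu₀D
  have hzero : S ((0 : ℝ≥0) : ℝ) u₀ = u₀ := H.zero u₀ hu₀D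
  have hMM : minimizingMovements φ u₀ = {fun t : ℝ≥0 => S t u₀} := by
    refine Subset.antisymm ?_ ?_
    · rintro u ⟨-, η, hη, τ₁, hτ₁, U, hU, hlim⟩
      refine funext fun t => tendsto_nhds_unique (hlim t) (Metric.tendsto_nhds.2 fun ε hε => ?_)
      obtain ⟨τ₂, hτ₂, h⟩ := hconv η hη t ε hε
      filter_upwards [Ioo_mem_nhdsGT hτ₁, Ioo_mem_nhdsGT hτ₂] with τ h1 h2
      exact h τ h2 _ (hU τ h1)
    · rintro _ rfl
      have : Nonempty X := ⟨u₀⟩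
      choose! U hU using hex
      refine ⟨hzero, 1, zero_le_one, τ₀, hτ₀, U, hU, fun t => Metric.tendsto_nhds.2 fun ε hε => ?_⟩
      obtain ⟨τ₂, hτ₂, h⟩ := hconv 1 zero_le_one t ε hε
      filter_upwards [Ioo_mem_nhdsGT hτ₀, Ioo_mem_nhdsGT hτ₂] with τ h1 h2
      exact h τ h2 _ (hU τ h1)
  refine ⟨?_, hMM⟩
  rw [hMM]
  refine Subset.antisymm ?_ ?_
  · rintro u ⟨-, η, hη, τ, hτ, hτlim, U, hU, hlim⟩
    refine funext fun t => tendsto_nhds_unique (hlim t) (Metric.tendsto_nhds.2 fun ε hε => ?_)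
    obtain ⟨τ₂, hτ₂, h⟩ := hconv η hη t ε hε
    filter_upwards [hτlim.eventually_lt_const hτ₂] with k hk
    exact h _ ⟨hτ k, hk⟩ _ (hU k)
  · rintro _ rfl
    -- The shift to k + 2 keeps every step, including k = 0, strictly below `τ₀`.
    have hτ : ∀ k : ℕ, τ₀ * (1 / ((k : ℝ) + 1 + 1)) ∈ Ioo 0 τ₀ := fun k => by
      refine ⟨by positivity, ?_⟩
      have : (1 : ℝ) / ((k : ℝ) + 1 + 1) < 1 := by
        rw [div_lt_one (by positivity)]
        linarith [(Nat.cast_nonneg k : (0 : ℝ) ≤ k)]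
      nlinarith
    have hτlim : Tendsto (fun k : ℕ => τ₀ * (1 / ((k : ℝ) + 1 + 1))) atTop (𝓝 0) := by
      have := (tendsto_one_div_add_atTop_nhds_zero_nat (𝕜 := ℝ)).comp (tendsto_add_atTop_nat 1)
      simpa [Function.comp_def] using this.const_mul τ₀
    choose U hU using fun k => hex _ (hτ k)
    refine ⟨hzero, 1, zero_le_one, _, fun k => (hτ k).1, hτlim, U, hU, fun t =>
      Metric.tendsto_nhds.2 fun ε hε => ?_⟩
    obtain ⟨τ₂, hτ₂, h⟩ := hconv 1 zero_le_one t ε hε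
    filter_upwards [hτlim.eventually_lt_const hτ₂] with k hk
    exact h _ ⟨(hτ k).1, hk⟩ _ (hU k)
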